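/- Let $(M,g)$ be a space-time of dimension $n>3$, i.e. a smooth $n$-manifold with a smooth Lorentzian metric $g$ of signature $(-,+,\dots,+)$, with Levi-Civita connection $\nabla$ and Weyl tensor $C_{jklm}$. For a vector field $u$ let $E_{kl}=u^ju^mC_{jklm}$ be the electric part of the Weyl tensor relative to $u$. Assume that the Weyl tensor is divergence-free, $\nabla^pC_{jklp}=0$. (a) If $(M,g)$ is twisted in the covariant sense, i.e. there are a smooth vector field $u$ with $u_ku^k=-1$ and a scalar field $\varphi$ such that $\nabla_iu_j=\varphi\,(g_{ij}+u_iu_j)$, then, for any such $u$ and $\varphi$, everywhere on $M$ $$\nabla_pE^{pk}=0\qquad\text{and}\qquad u^p\nabla_pE_{km}=-\varphi\,(n-1)\,E_{km}.$$ (b) In any coordinate chart in which the metric has the twisted form $ds^2=-dt^2+f(x,t)^2\,g^*_{\mu\nu}(x)\,dx^\mu dx^\nu$, with $f>0$ smooth and $g^*$ a Riemannian metric in the $n-1$ variables $x$, the same two identities hold for $u=\partial_t$ and $\varphi=\partial_tf/f$. -/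

import Mathlib

open scoped Manifold ContDiff

noncomputable section

namespace Spacetime

/-! ### Tensor calculus in coordinates

`G` is the matrix of components `g_{ij}` of a metric as a function of the coordinates
`y ∈ ℝⁿ`; lower-index components of tensors are functions of the same coordinates.
Indices are written in the order in which they occur in the usual notation. -/

section Coordinates

variable {n : ℕ}

/-- The partial derivative `∂_i F`. -/
def pd (i : Fin n) (F : EuclideanSpace ℝ (Fin n) → ℝ) (y : EuclideanSpace ℝ (Fin n)) : ℝ :=
  fderiv ℝ F y (EuclideanSpace.single i 1)

/-- The components `g^{ij}` of the inverse metric. -/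
def ginv (G : EuclideanSpace ℝ (Fin n) → Matrix (Fin n) (Fin n) ℝ)
    (y : EuclideanSpace ℝ (Fin n)) (i j : Fin n) : ℝ :=
  ((G y)⁻¹ : Matrix (Fin n) (Fin n) ℝ) i j

/-- The Christoffel symbol `Γ^k_{ij}` of the Levi-Civita connection. -/
def christoffel (G : EuclideanSpace ℝ (Fin n) → Matrix (Fin n) (Fin n) ℝ)
    (y : EuclideanSpace ℝ (Fin n)) (k i j : Fin n) : ℝ :=
  (1 / 2) * ∑ l, ginv G y k l *
    (pd i (fun z => G z j l) y + pd j (fun z => G z i l) y - pd l (fun z => G z i j) y)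

/-- The covariant derivative `∇_i w_j` of a covector field. -/
def nabla1 (G : EuclideanSpace ℝ (Fin n) → Matrix (Fin n) (Fin n) ℝ)
    (w : EuclideanSpace ℝ (Fin n) → Fin n → ℝ)
    (y : EuclideanSpace ℝ (Fin n)) (i j : Fin n) : ℝ :=
  pd i (fun z => w z j) y - ∑ q, christoffel G y q i j * w y q

/-- The covariant derivative `∇_i T_{jk}`. -/
def nabla2 (G : EuclideanSpace ℝ (Fin n) → Matrix (Fin n) (Fin n) ℝ)
    (T : EuclideanSpace ℝ (Fin n) → Fin n → Fin n → ℝ)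
    (y : EuclideanSpace ℝ (Fin n)) (i j k : Fin n) : ℝ :=
  pd i (fun z => T z j k) y
    - ∑ q, christoffel G y q i j * T y q k
    - ∑ q, christoffel G y q i k * T y j q

/-- The covariant derivative `∇_i T_{jklm}`. -/
def nabla4 (G : EuclideanSpace ℝ (Fin n) → Matrix (Fin n) (Fin n) ℝ)
    (T : EuclideanSpace ℝ (Fin n) → Fin n → Fin n → Fin n → Fin n → ℝ)
    (y : EuclideanSpace ℝ (Fin n)) (i j k l m : Fin n) : ℝ :=
  pd i (fun z => T z j k l m) y
    - ∑ q, christoffel G y q i j * T y q k l m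
    - ∑ q, christoffel G y q i k * T y j q l m
    - ∑ q, christoffel G y q i l * T y j k q m
    - ∑ q, christoffel G y q i m * T y j k l q

/-- The Riemann tensor `R_{jkl}{}^m`, with the convention
`∇_j ∇_k w_l - ∇_k ∇_j w_l = R_{jkl}{}^m w_m`. -/
def riemannUp (G : EuclideanSpace ℝ (Fin n) → Matrix (Fin n) (Fin n) ℝ)
    (y : EuclideanSpace ℝ (Fin n)) (j k l m : Fin n) : ℝ :=
  pd k (fun z => christoffel G z m j l) y - pd j (fun z => christoffel G z m k l) y
    + ∑ q, (christoffel G y q j l * christoffel G y m k q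
      - christoffel G y q k l * christoffel G y m j q)

/-- The Riemann tensor `R_{jklm} = R_{jkl}{}^p g_{pm}`. -/
def riemann (G : EuclideanSpace ℝ (Fin n) → Matrix (Fin n) (Fin n) ℝ)
    (y : EuclideanSpace ℝ (Fin n)) (j k l m : Fin n) : ℝ :=
  ∑ p, riemannUp G y j k l p * G y p m

/-- The Ricci tensor `R_{kl} = -R_{mkl}{}^m` (positive on round spheres). -/
def ricci (G : EuclideanSpace ℝ (Fin n) → Matrix (Fin n) (Fin n) ℝ)
    (y : EuclideanSpace ℝ (Fin n)) (k l : Fin n) : ℝ :=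
  -∑ m, riemannUp G y m k l m

/-- The scalar curvature `R = g^{kl} R_{kl}`. -/
def scalarCurv (G : EuclideanSpace ℝ (Fin n) → Matrix (Fin n) (Fin n) ℝ)
    (y : EuclideanSpace ℝ (Fin n)) : ℝ :=
  ∑ k, ∑ l, ginv G y k l * ricci G y k l

/-- The Weyl tensor `C_{jklm}`. -/
def weyl (G : EuclideanSpace ℝ (Fin n) → Matrix (Fin n) (Fin n) ℝ)
    (y : EuclideanSpace ℝ (Fin n)) (j k l m : Fin n) : ℝ :=
  riemann G y j k l m
    + 1 / ((n : ℝ) - 2) * (G y j m * ricci G y k l - G y k m * ricci G y j l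
      + ricci G y j m * G y k l - ricci G y k m * G y j l)
    - scalarCurv G y / (((n : ℝ) - 1) * ((n : ℝ) - 2))
      * (G y j m * G y k l - G y k m * G y j l)

/-- The divergence `∇^p C_{jklp}` of the Weyl tensor. -/
def divWeyl (G : EuclideanSpace ℝ (Fin n) → Matrix (Fin n) (Fin n) ℝ)
    (y : EuclideanSpace ℝ (Fin n)) (j k l : Fin n) : ℝ :=
  ∑ p, ∑ q, ginv G y p q * nabla4 G (weyl G) y q j k l p

/-- Lowering an index: `u_j = g_{jk} u^k`. -/
def lower (G : EuclideanSpace ℝ (Fin n) → Matrix (Fin n) (Fin n) ℝ)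
    (u : EuclideanSpace ℝ (Fin n) → Fin n → ℝ)
    (y : EuclideanSpace ℝ (Fin n)) (j : Fin n) : ℝ :=
  ∑ k, G y j k * u y k

/-- The electric part `E_{kl} = u^j u^m C_{jklm}` of the Weyl tensor relative to the vector
field with components `u^i`. -/
def electric (G : EuclideanSpace ℝ (Fin n) → Matrix (Fin n) (Fin n) ℝ)
    (u : EuclideanSpace ℝ (Fin n) → Fin n → ℝ)
    (y : EuclideanSpace ℝ (Fin n)) (k l : Fin n) : ℝ :=
  ∑ j, ∑ m, u y j * u y m * weyl G y j k l m

/-- The divergence `∇_p E^{pk} = g^{pa} g^{kb} ∇_p E_{ab}`. -/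
def divElectric (G : EuclideanSpace ℝ (Fin n) → Matrix (Fin n) (Fin n) ℝ)
    (u : EuclideanSpace ℝ (Fin n) → Fin n → ℝ)
    (y : EuclideanSpace ℝ (Fin n)) (k : Fin n) : ℝ :=
  ∑ p, ∑ a, ∑ b, ginv G y p a * ginv G y k b * nabla2 G (electric G u) y p a b

/-- The derivative along `u`, `u^p ∇_p E_{km}`. -/
def alongElectric (G : EuclideanSpace ℝ (Fin n) → Matrix (Fin n) (Fin n) ℝ)
    (u : EuclideanSpace ℝ (Fin n) → Fin n → ℝ)
    (y : EuclideanSpace ℝ (Fin n)) (k m : Fin n) : ℝ :=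
  ∑ p, u y p * nabla2 G (electric G u) y p k m

/-- On the coordinate domain `S`, the metric with components `G` has the twisted form
`ds² = -dt² + f(x,t)² g*_{μν}(x) dx^μ dx^ν`. The coordinate number `t` is the time, the others
are the space coordinates `x`; `f > 0` and `g*` is a Riemannian metric in the variables `x`. -/
structure IsTwistedForm (G : EuclideanSpace ℝ (Fin n) → Matrix (Fin n) (Fin n) ℝ)
    (S : Set (EuclideanSpace ℝ (Fin n))) (t : Fin n) (f : EuclideanSpace ℝ (Fin n) → ℝ)
    (gstar : ({i : Fin n // i ≠ t} → ℝ) → Matrix {i : Fin n // i ≠ t} {i : Fin n // i ≠ t} ℝ) :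
    Prop where
  scale_smooth : ContDiffOn ℝ ∞ f S
  scale_pos : ∀ y ∈ S, 0 < f y
  star_smooth : ∀ μ ν, ContDiffOn ℝ ∞ (fun x => gstar x μ ν) ((fun y μ => y μ.1) '' S)
  star_posDef : ∀ y ∈ S, (gstar fun μ => y μ.1).PosDef
  time_time : ∀ y ∈ S, G y t t = -1
  time_space : ∀ y ∈ S, ∀ μ : {i : Fin n // i ≠ t}, G y t μ.1 = 0 ∧ G y μ.1 t = 0
  space_space : ∀ y ∈ S, ∀ μ ν : {i : Fin n // i ≠ t},
    G y μ.1 ν.1 = f y ^ 2 * gstar (fun ρ => y ρ.1) μ ν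

end Coordinates

/-! ### Space-times -/

section Manifold

variable {n : ℕ} {M : Type*} [TopologicalSpace M] [ChartedSpace (EuclideanSpace ℝ (Fin n)) M]

/-- The coordinate vector field `∂_i` of the chart `e`, at the point with coordinates `y`. -/
def coordVec (e : OpenPartialHomeomorph M (EuclideanSpace ℝ (Fin n)))
    (y : EuclideanSpace ℝ (Fin n)) (i : Fin n) : TangentSpace (𝓡 n) (e.symm y) :=
  mfderiv (𝓡 n) (𝓡 n) e.symm y (EuclideanSpace.single i (1 : ℝ) : EuclideanSpace ℝ (Fin n))

/-- The components `u^i` of a vector field in the chart `e`. -/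
def vecComp (u : ∀ x : M, TangentSpace (𝓡 n) x)
    (e : OpenPartialHomeomorph M (EuclideanSpace ℝ (Fin n)))
    (y : EuclideanSpace ℝ (Fin n)) (i : Fin n) : ℝ :=
  (EuclideanSpace.proj i : EuclideanSpace ℝ (Fin n) →L[ℝ] ℝ)
    (mfderiv (𝓡 n) (𝓡 n) e (e.symm y) (u (e.symm y)))

/-- The components `g_{ij}` of a field of bilinear forms in the chart `e`. -/
def metricComp (g : ∀ x : M, LinearMap.BilinForm ℝ (TangentSpace (𝓡 n) x))
    (e : OpenPartialHomeomorph M (EuclideanSpace ℝ (Fin n)))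
    (y : EuclideanSpace ℝ (Fin n)) : Matrix (Fin n) (Fin n) ℝ :=
  Matrix.of fun i j => g (e.symm y) (coordVec e y i) (coordVec e y j)

/-- A smooth Lorentzian metric of signature `(-, +, …, +)`: symmetric, with an orthonormal basis
of this signature in every tangent space, and with smooth components in every chart. -/
structure IsLorentzian [IsManifold (𝓡 n) ∞ M]
    (g : ∀ x : M, LinearMap.BilinForm ℝ (TangentSpace (𝓡 n) x)) : Prop where
  symm : ∀ x v w, g x v w = g x w v
  signature : ∀ x, ∃ b : Module.Basis (Fin n) ℝ (TangentSpace (𝓡 n) x), ∀ i j : Fin n,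
    g x (b i) (b j) = if i = j then (if (i : ℕ) = 0 then -1 else 1) else 0
  smooth : ∀ e ∈ IsManifold.maximalAtlas (𝓡 n) ∞ M, ∀ i j,
    ContDiffOn ℝ ∞ (fun y => metricComp g e y i j) e.target

/-- A vector field whose components are smooth in every chart. -/
def IsSmoothField [IsManifold (𝓡 n) ∞ M] (u : ∀ x : M, TangentSpace (𝓡 n) x) : Prop :=
  ∀ e ∈ IsManifold.maximalAtlas (𝓡 n) ∞ M, ∀ i,
    ContDiffOn ℝ ∞ (fun y => vecComp u e y i) e.target

/-- `∇_i u_j = φ (g_{ij} + u_i u_j)`: the vector field `u` is free of shear, vorticity and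
acceleration, with scalar field `φ`. -/
def IsTorseForming [IsManifold (𝓡 n) ∞ M]
    (g : ∀ x : M, LinearMap.BilinForm ℝ (TangentSpace (𝓡 n) x))
    (u : ∀ x : M, TangentSpace (𝓡 n) x) (φ : M → ℝ) : Prop :=
  ∀ e ∈ IsManifold.maximalAtlas (𝓡 n) ∞ M, ∀ y ∈ e.target, ∀ i j,
    nabla1 (metricComp g e) (lower (metricComp g e) (vecComp u e)) y i j
      = φ (e.symm y) * (metricComp g e y i j
        + lower (metricComp g e) (vecComp u e) y i * lower (metricComp g e) (vecComp u e) y j)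

/-- The Weyl tensor is divergence-free: `∇^p C_{jklp} = 0`. -/
def IsWeylDivFree [IsManifold (𝓡 n) ∞ M]
    (g : ∀ x : M, LinearMap.BilinForm ℝ (TangentSpace (𝓡 n) x)) : Prop :=
  ∀ e ∈ IsManifold.maximalAtlas (𝓡 n) ∞ M, ∀ y ∈ e.target, ∀ j k l,
    divWeyl (metricComp g e) y j k l = 0

end Manifold

end Spacetime

end

noncomputable section

namespace Spacetime

section

/-! ### Partial derivatives and smoothness in coordinates. -/

section Calculus

variable {n : ℕ} {S : Set (EuclideanSpace ℝ (Fin n))} {y : EuclideanSpace ℝ (Fin n)}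
  {F H : EuclideanSpace ℝ (Fin n) → ℝ}

/-! Everything is local, so the argument runs in one chart, for a smooth nondegenerate metric and a
unit field with ∇_i u_j = φ h_{ij}, where h_{ij} = g_{ij} + u_i u_j.

Structure of the Weyl tensor. The Ricci identity for u gives R_{jkl}{}^m u_m = a_j h_{kl} - a_k
h_{jl} with a_j = ∂_jφ - φ² u_j. Its trace gives the contraction of the Ricci tensor with u. In u^m
C_{jklm} the terms a_j g_{kl} cancel, and what remains has the form u_j X_{kl} - u_k X_{jl}.
Contracting with u^j and using u·u = -1 yields u^m C_{jklm} = u_k E_{jl} - u_j E_{kl}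
(`sum_mul_weyl`): relative to u the Weyl tensor has no magnetic part.

Divergence of W_{klm} = u^j C_{jklm}. By Leibniz and ∇_p u^j = φ(δ_p^j + u_p u^j), the divergence on
the last index is φ E_{kl}; the other terms vanish because C is trace-free and divergence-free
(`sum_ginv_nabla3_weylVec`). Writing E_{kl} = u^m W_{klm}, the antisymmetry of W in its last two
indices reduces the divergence of E to -φ u^m E_{km} = 0.

Evolution of E. The structure formula says W_{klm} = u_l E_{mk} - u_m E_{lk}. Its divergence is φ
E_{kl} - (n-1)φ E_{kl} - u^p∇_pE_{kl}, once div E = 0 and u^m E_{km} = 0 are used. Equating this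
with φ E_{kl} proves the second identity (`alongElectric_eq`).

For the twisted form, ∂_t is such a field with φ = ∂_t f / f, so the coordinate statement is a
special case of the local one. -/

theorem pd_congr (hS : IsOpen S) (hy : y ∈ S) (h : ∀ z ∈ S, F z = H z) (i : Fin n) :
    pd i F y = pd i H y := by
  have : F =ᶠ[nhds y] H := Filter.eventuallyEq_of_mem (hS.mem_nhds hy) h
  rw [pd, pd, this.fderiv_eq]

theorem differentiableAt_of_smooth (hS : IsOpen S) (hy : y ∈ S) (hF : ContDiffOn ℝ ∞ F S) :
    DifferentiableAt ℝ F y :=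
  (hF.contDiffAt (hS.mem_nhds hy)).differentiableAt (by simp)

theorem contDiffOn_pd (hS : IsOpen S) (hF : ContDiffOn ℝ ∞ F S) (i : Fin n) :
    ContDiffOn ℝ ∞ (pd i F) S :=
  ((contDiffOn_infty_iff_fderiv_of_isOpen hS).1 hF).2.clm_apply contDiffOn_const

theorem pd_const (c : ℝ) (i : Fin n) : pd i (fun _ => c) y = 0 := by
  simp [pd]

theorem pd_add (hF : DifferentiableAt ℝ F y) (hH : DifferentiableAt ℝ H y) (i : Fin n) :
    pd i (fun z => F z + H z) y = pd i F y + pd i H y := by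
  simp only [pd]; rw [fderiv_fun_add hF hH]; simp

theorem pd_sub (hF : DifferentiableAt ℝ F y) (hH : DifferentiableAt ℝ H y) (i : Fin n) :
    pd i (fun z => F z - H z) y = pd i F y - pd i H y := by
  simp only [pd]; rw [fderiv_fun_sub hF hH]; simp

theorem pd_neg (i : Fin n) : pd i (fun z => -F z) y = -pd i F y := by
  simp only [pd]; rw [fderiv_fun_neg]; simp

theorem pd_mul (hF : DifferentiableAt ℝ F y) (hH : DifferentiableAt ℝ H y) (i : Fin n) :
    pd i (fun z => F z * H z) y = pd i F y * H y + F y * pd i H y := by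
  simp only [pd]; rw [fderiv_fun_mul hF hH]; simp; ring

theorem pd_sum {ι : Type*} {s : Finset ι} {K : ι → EuclideanSpace ℝ (Fin n) → ℝ}
    (hK : ∀ a ∈ s, DifferentiableAt ℝ (K a) y) (i : Fin n) :
    pd i (fun z => ∑ a ∈ s, K a z) y = ∑ a ∈ s, pd i (K a) y := by
  simp only [pd]; rw [fderiv_fun_sum hK]; simp

theorem pd_comm (hS : IsOpen S) (hy : y ∈ S) (hF : ContDiffOn ℝ ∞ F S) (i j : Fin n) :
    pd i (pd j F) y = pd j (pd i F) y := by
  have hc := hF.contDiffAt (hS.mem_nhds hy)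
  have hs : IsSymmSndFDerivAt ℝ F y := hc.isSymmSndFDerivAt (by
    rw [minSmoothness_of_isRCLikeNormedField]; exact WithTop.coe_le_coe.2 (le_top : (2 : ℕ∞) ≤ ⊤))
  have hd : DifferentiableAt ℝ (fderiv ℝ F) y :=
    (((contDiffOn_infty_iff_fderiv_of_isOpen hS).1 hF).2.contDiffAt
      (hS.mem_nhds hy)).differentiableAt (by simp)
  have key : ∀ a b : Fin n, pd a (pd b F) y
      = fderiv ℝ (fderiv ℝ F) y (EuclideanSpace.single a 1) (EuclideanSpace.single b 1) := by
    intro a b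
    have : pd b F = fun z => fderiv ℝ F z (EuclideanSpace.single b 1) := rfl
    rw [this, pd, fderiv_clm_apply hd (differentiableAt_const _)]
    simp
  rw [key, key, hs.eq]

theorem contDiffOn_det {A : EuclideanSpace ℝ (Fin n) → Matrix (Fin n) (Fin n) ℝ}
    (hA : ∀ i j, ContDiffOn ℝ ∞ (fun z => A z i j) S) :
    ContDiffOn ℝ ∞ (fun z => (A z).det) S := by
  simp only [Matrix.det_apply']
  exact ContDiffOn.sum fun σ _ =>
    contDiffOn_const.mul (contDiffOn_prod fun i _ => hA (σ i) i)

/-- By Cramer's rule each entry of the inverse is a quotient of determinants, hence smooth where the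
denominator does not vanish. -/
theorem contDiffOn_ginv {A : EuclideanSpace ℝ (Fin n) → Matrix (Fin n) (Fin n) ℝ}
    (hA : ∀ i j, ContDiffOn ℝ ∞ (fun z => A z i j) S) (hdet : ∀ z ∈ S, (A z).det ≠ 0)
    (i j : Fin n) : ContDiffOn ℝ ∞ (fun z => ginv A z i j) S := by
  have h : (fun z => ginv A z i j)
      = fun z => ((A z).det)⁻¹ * ((A z).updateRow j (Pi.single i 1)).det := by
    funext z
    simp [ginv, Matrix.inv_def, Matrix.adjugate_apply]
  rw [h]
  refine (contDiffOn_det hA).inv hdet |>.mul (contDiffOn_det fun a b => ?_)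
  by_cases hab : a = j
  · subst hab; simpa using contDiffOn_const
  · simpa [Matrix.updateRow_ne hab] using hA a b

end Calculus

/-- The matrices `G` are the components on `S` of a smooth nondegenerate metric. -/
structure IsMetricOn {n : ℕ} (G : EuclideanSpace ℝ (Fin n) → Matrix (Fin n) (Fin n) ℝ)
    (S : Set (EuclideanSpace ℝ (Fin n))) : Prop where
  isOpen : IsOpen S
  symm : ∀ y ∈ S, ∀ i j, G y i j = G y j i
  det_ne_zero : ∀ y ∈ S, (G y).det ≠ 0
  smooth : ∀ i j, ContDiffOn ℝ ∞ (fun y => G y i j) S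

/-! ### Smoothness of the curvature components; the inverse metric. -/

namespace IsMetricOn

variable {n : ℕ} {G : EuclideanSpace ℝ (Fin n) → Matrix (Fin n) (Fin n) ℝ}
  {S : Set (EuclideanSpace ℝ (Fin n))} {y : EuclideanSpace ℝ (Fin n)}

theorem contDiffOn_ginv (hG : IsMetricOn G S) (i j : Fin n) :
    ContDiffOn ℝ ∞ (fun z => ginv G z i j) S :=
  Spacetime.contDiffOn_ginv hG.smooth hG.det_ne_zero i j

theorem contDiffOn_christoffel (hG : IsMetricOn G S) (k i j : Fin n) :
    ContDiffOn ℝ ∞ (fun z => christoffel G z k i j) S := by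
  unfold christoffel
  exact contDiffOn_const.mul (ContDiffOn.sum fun l _ => (hG.contDiffOn_ginv k l).mul
    (((contDiffOn_pd hG.isOpen (hG.smooth j l) i).add
      (contDiffOn_pd hG.isOpen (hG.smooth i l) j)).sub
      (contDiffOn_pd hG.isOpen (hG.smooth i j) l)))

theorem contDiffOn_riemannUp (hG : IsMetricOn G S) (j k l m : Fin n) :
    ContDiffOn ℝ ∞ (fun z => riemannUp G z j k l m) S := by
  unfold riemannUp
  exact ((contDiffOn_pd hG.isOpen (hG.contDiffOn_christoffel m j l) k).sub
    (contDiffOn_pd hG.isOpen (hG.contDiffOn_christoffel m k l) j)).add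
    (ContDiffOn.sum fun q _ =>
      ((hG.contDiffOn_christoffel q j l).mul (hG.contDiffOn_christoffel m k q)).sub
      ((hG.contDiffOn_christoffel q k l).mul (hG.contDiffOn_christoffel m j q)))

theorem contDiffOn_riemann (hG : IsMetricOn G S) (j k l m : Fin n) :
    ContDiffOn ℝ ∞ (fun z => riemann G z j k l m) S := by
  unfold riemann
  exact ContDiffOn.sum fun p _ => (hG.contDiffOn_riemannUp j k l p).mul (hG.smooth p m)

theorem contDiffOn_ricci (hG : IsMetricOn G S) (k l : Fin n) :
    ContDiffOn ℝ ∞ (fun z => ricci G z k l) S := by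
  unfold ricci
  exact (ContDiffOn.sum fun m _ => hG.contDiffOn_riemannUp m k l m).neg

theorem contDiffOn_scalarCurv (hG : IsMetricOn G S) :
    ContDiffOn ℝ ∞ (fun z => scalarCurv G z) S := by
  unfold scalarCurv
  exact ContDiffOn.sum fun k _ => ContDiffOn.sum fun l _ =>
    (hG.contDiffOn_ginv k l).mul (hG.contDiffOn_ricci k l)

theorem contDiffOn_weyl (hG : IsMetricOn G S) (j k l m : Fin n) :
    ContDiffOn ℝ ∞ (fun z => weyl G z j k l m) S := by
  unfold weyl
  have hr := hG.contDiffOn_ricci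
  have hg := hG.smooth
  exact ((hG.contDiffOn_riemann j k l m).add (contDiffOn_const.mul
    (((((hg j m).mul (hr k l)).sub ((hg k m).mul (hr j l))).add
      ((hr j m).mul (hg k l))).sub ((hr k m).mul (hg j l))))).sub
    ((hG.contDiffOn_scalarCurv.div_const _).mul
      (((hg j m).mul (hg k l)).sub ((hg k m).mul (hg j l))))

theorem ginv_symm (hG : IsMetricOn G S) (hy : y ∈ S) (i j : Fin n) :
    ginv G y i j = ginv G y j i := by
  have h : (G y).transpose = G y := by ext a b; exact hG.symm y hy b a
  have h2 : (G y)⁻¹.transpose = (G y)⁻¹ := by rw [Matrix.transpose_nonsing_inv, h]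
  exact (congrFun (congrFun h2 i) j).symm

theorem sum_ginv_mul_metric (hG : IsMetricOn G S) (hy : y ∈ S) (i j : Fin n) :
    ∑ k, ginv G y i k * G y k j = if i = j then 1 else 0 := by
  have := Matrix.nonsing_inv_mul (G y) (isUnit_iff_ne_zero.2 (hG.det_ne_zero y hy))
  simpa [ginv, Matrix.mul_apply, Matrix.one_apply] using congrFun (congrFun this i) j

end IsMetricOn

end

/-! ### Symmetries of the Riemann, Ricci and Weyl tensors. -/

section

open scoped Matrix

section MatrixCalculus

variable {n : ℕ} {S : Set (EuclideanSpace ℝ (Fin n))} {y : EuclideanSpace ℝ (Fin n)}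
  {A B : EuclideanSpace ℝ (Fin n) → Matrix (Fin n) (Fin n) ℝ}

/-- The entrywise partial derivative of a matrix of functions. -/
def pdMatrix (i : Fin n) (A : EuclideanSpace ℝ (Fin n) → Matrix (Fin n) (Fin n) ℝ)
    (y : EuclideanSpace ℝ (Fin n)) : Matrix (Fin n) (Fin n) ℝ :=
  Matrix.of fun a b => pd i (fun z => A z a b) y

/-- A matrix of functions with smooth entries. -/
def SmoothMatrixOn (A : EuclideanSpace ℝ (Fin n) → Matrix (Fin n) (Fin n) ℝ)
    (S : Set (EuclideanSpace ℝ (Fin n))) : Prop :=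
  ∀ a b, ContDiffOn ℝ ∞ (fun z => A z a b) S

theorem SmoothMatrixOn.mul (hA : SmoothMatrixOn A S) (hB : SmoothMatrixOn B S) :
    SmoothMatrixOn (fun z => A z * B z) S := fun a b => by
  simp only [Matrix.mul_apply]
  exact ContDiffOn.sum fun c _ => (hA a c).mul (hB c b)

theorem SmoothMatrixOn.transpose (hA : SmoothMatrixOn A S) :
    SmoothMatrixOn (fun z => (A z)ᵀ) S := fun a b => hA b a

theorem pdMatrix_transpose (i : Fin n) : pdMatrix i (fun z => (A z)ᵀ) y = (pdMatrix i A y)ᵀ := rfl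

theorem pdMatrix_congr (hS : IsOpen S) (hy : y ∈ S) (h : ∀ z ∈ S, A z = B z) (i : Fin n) :
    pdMatrix i A y = pdMatrix i B y := by
  ext a b
  exact pd_congr hS hy (fun z hz => by rw [h z hz]) i

theorem pdMatrix_add (hS : IsOpen S) (hy : y ∈ S) (hA : SmoothMatrixOn A S)
    (hB : SmoothMatrixOn B S) (i : Fin n) :
    pdMatrix i (fun z => A z + B z) y = pdMatrix i A y + pdMatrix i B y := by
  ext a b
  exact pd_add (differentiableAt_of_smooth hS hy (hA a b))
    (differentiableAt_of_smooth hS hy (hB a b)) i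

theorem pdMatrix_mul (hS : IsOpen S) (hy : y ∈ S) (hA : SmoothMatrixOn A S)
    (hB : SmoothMatrixOn B S) (i : Fin n) :
    pdMatrix i (fun z => A z * B z) y = pdMatrix i A y * B y + A y * pdMatrix i B y := by
  ext a b
  simp only [pdMatrix, Matrix.mul_apply, Matrix.add_apply, Matrix.of_apply]
  rw [pd_sum (fun c _ => (differentiableAt_of_smooth hS hy (hA a c)).fun_mul
    (differentiableAt_of_smooth hS hy (hB c b))), ← Finset.sum_add_distrib]
  exact Finset.sum_congr rfl fun c _ => pd_mul (differentiableAt_of_smooth hS hy (hA a c))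
    (differentiableAt_of_smooth hS hy (hB c b)) i

theorem pdMatrix_comm (hS : IsOpen S) (hy : y ∈ S) (hA : SmoothMatrixOn A S) (i j : Fin n) :
    pdMatrix i (pdMatrix j A) y = pdMatrix j (pdMatrix i A) y := by
  ext a b
  exact pd_comm hS hy (hA a b) i j

end MatrixCalculus

variable {n : ℕ} {G : EuclideanSpace ℝ (Fin n) → Matrix (Fin n) (Fin n) ℝ}
  {S : Set (EuclideanSpace ℝ (Fin n))} {y : EuclideanSpace ℝ (Fin n)}

/-- The connection matrix with entries `(j, q) ↦ Γ^q_{ij}`. -/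
def connMatrix (G : EuclideanSpace ℝ (Fin n) → Matrix (Fin n) (Fin n) ℝ) (i : Fin n)
    (y : EuclideanSpace ℝ (Fin n)) : Matrix (Fin n) (Fin n) ℝ :=
  Matrix.of fun j q => christoffel G y q i j

/-- The curvature matrix with entries `(l, m) ↦ R_{jkl}{}^m`. -/
def curvMatrix (G : EuclideanSpace ℝ (Fin n) → Matrix (Fin n) (Fin n) ℝ) (j k : Fin n)
    (y : EuclideanSpace ℝ (Fin n)) : Matrix (Fin n) (Fin n) ℝ :=
  Matrix.of fun l m => riemannUp G y j k l m

/-- The curvature as the curvature form of the connection matrices, so that metric compatibility can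
be differentiated by noncommutative algebra. -/
theorem curvMatrix_eq (j k : Fin n) :
    curvMatrix G j k y = pdMatrix k (connMatrix G j) y - pdMatrix j (connMatrix G k) y
      + connMatrix G j y * connMatrix G k y - connMatrix G k y * connMatrix G j y := by
  ext l m
  simp only [curvMatrix, riemannUp, pdMatrix, connMatrix, Matrix.of_apply, Matrix.sub_apply,
    Matrix.add_apply, Matrix.mul_apply, Finset.sum_sub_distrib]
  ring

theorem riemannUp_antisymm (j k l m : Fin n) :
    riemannUp G y k j l m = -riemannUp G y j k l m := by
  simp only [riemannUp, Finset.sum_sub_distrib]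
  ring

theorem riemann_antisymm_left (j k l m : Fin n) :
    riemann G y k j l m = -riemann G y j k l m := by
  simp only [riemann, riemannUp_antisymm j k, neg_mul, Finset.sum_neg_distrib]

theorem weyl_antisymm_left (j k l m : Fin n) :
    weyl G y k j l m = -weyl G y j k l m := by
  simp only [weyl]
  rw [riemann_antisymm_left]
  ring

namespace IsMetricOn

theorem smooth_connMatrix (hG : IsMetricOn G S) (i : Fin n) :
    SmoothMatrixOn (connMatrix G i) S := fun a b => hG.contDiffOn_christoffel b i a

theorem christoffel_symm (hG : IsMetricOn G S) (hy : y ∈ S) (k i j : Fin n) :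
    christoffel G y k i j = christoffel G y k j i := by
  unfold christoffel
  congr 1
  refine Finset.sum_congr rfl fun l _ => ?_
  rw [pd_congr hG.isOpen hy (fun z hz => hG.symm z hz i j) l]
  ring

theorem sum_christoffel_mul_metric (hG : IsMetricOn G S) (hy : y ∈ S) (i j m : Fin n) :
    ∑ q, christoffel G y q i j * G y q m = (1 / 2) * (pd i (fun z => G z j m) y
      + pd j (fun z => G z i m) y - pd m (fun z => G z i j) y) := by
  simp only [christoffel]
  simp_rw [mul_assoc, ← Finset.mul_sum, Finset.sum_mul]
  rw [Finset.sum_comm]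
  congr 1
  have : ∀ l, ∑ q, ginv G y q l * (pd i (fun z => G z j l) y
      + pd j (fun z => G z i l) y - pd l (fun z => G z i j) y) * G y q m
      = (if l = m then 1 else 0) * (pd i (fun z => G z j l) y
      + pd j (fun z => G z i l) y - pd l (fun z => G z i j) y) := fun l => by
    rw [← hG.sum_ginv_mul_metric hy, Finset.sum_mul]
    refine Finset.sum_congr rfl fun q _ => ?_
    rw [hG.ginv_symm hy q l]; ring
  simp [this]

/-- This is ∇g = 0: in the sum of the two lowered Christoffel symbols all derivatives except ∂_i
g_{jk} cancel. -/
theorem pd_metric (hG : IsMetricOn G S) (hy : y ∈ S) (i j k : Fin n) :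
    pd i (fun z => G z j k) y = ∑ q, christoffel G y q i j * G y q k
      + ∑ q, christoffel G y q i k * G y j q := by
  have h : ∑ q, christoffel G y q i k * G y j q = ∑ q, christoffel G y q i k * G y q j :=
    Finset.sum_congr rfl fun q _ => by rw [hG.symm y hy j q]
  rw [h, hG.sum_christoffel_mul_metric hy, hG.sum_christoffel_mul_metric hy,
    pd_congr hG.isOpen hy (fun z hz => hG.symm z hz j k) i]
  ring

theorem pdMatrix_metric (hG : IsMetricOn G S) (hy : y ∈ S) (i : Fin n) :
    pdMatrix i G y = connMatrix G i y * G y + G y * (connMatrix G i y)ᵀ := by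
  ext j k
  simp only [pdMatrix, connMatrix, Matrix.of_apply, Matrix.add_apply, Matrix.mul_apply,
    Matrix.transpose_apply]
  rw [hG.pd_metric hy]
  congr 1
  exact Finset.sum_congr rfl fun q _ => mul_comm _ _

/-- Differentiating ∂_b g = A_b g + g A_bᵀ once more and equating mixed partials says that the
curvature acts on g by zero. This is the source of the antisymmetry of R_{jklm} in l and m. -/
theorem curvMatrix_mul_metric (hG : IsMetricOn G S) (hy : y ∈ S) (j k : Fin n) :
    curvMatrix G j k y * G y + G y * (curvMatrix G j k y)ᵀ = 0 := by
  have key : ∀ a b : Fin n, pdMatrix a (pdMatrix b G) y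
      = pdMatrix a (connMatrix G b) y * G y + connMatrix G b y * pdMatrix a G y
        + (pdMatrix a G y * (connMatrix G b y)ᵀ + G y * (pdMatrix a (connMatrix G b) y)ᵀ) := by
    intro a b
    have hA := hG.smooth_connMatrix b
    have hg : SmoothMatrixOn G S := hG.smooth
    rw [pdMatrix_congr hG.isOpen hy (fun z hz => hG.pdMatrix_metric hz b),
      pdMatrix_add hG.isOpen hy (hA.mul hg) (hg.mul hA.transpose),
      pdMatrix_mul hG.isOpen hy hA hg, pdMatrix_mul hG.isOpen hy hg hA.transpose,
      pdMatrix_transpose]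
  have h := pdMatrix_comm hG.isOpen hy hG.smooth k j
  rw [key, key, hG.pdMatrix_metric hy, hG.pdMatrix_metric hy, ← sub_eq_zero] at h
  rw [curvMatrix_eq, ← h]
  simp only [Matrix.transpose_add, Matrix.transpose_sub, Matrix.transpose_mul]
  noncomm_ring

theorem riemann_antisymm_right (hG : IsMetricOn G S) (hy : y ∈ S) (j k l m : Fin n) :
    riemann G y j k m l = -riemann G y j k l m := by
  have h := congrFun (congrFun (hG.curvMatrix_mul_metric hy j k) m) l
  simp only [Matrix.add_apply, Matrix.mul_apply, curvMatrix, Matrix.of_apply,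
    Matrix.transpose_apply, Matrix.zero_apply] at h
  have h2 : ∑ q, G y m q * riemannUp G y j k l q = riemann G y j k l m :=
    Finset.sum_congr rfl fun q _ => by rw [hG.symm y hy m q, mul_comm]
  rw [h2] at h
  exact eq_neg_of_add_eq_zero_left h

theorem riemannUp_cyclic (hG : IsMetricOn G S) (hy : y ∈ S) (j k l m : Fin n) :
    riemannUp G y j k l m + riemannUp G y k l j m + riemannUp G y l j k m = 0 := by
  have hs := fun a b c : Fin n => fun z hz => hG.christoffel_symm (y := z) hz a b c
  simp only [riemannUp, Finset.sum_sub_distrib]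
  rw [pd_congr hG.isOpen hy (hs m l j) k, pd_congr hG.isOpen hy (hs m l k) j,
    pd_congr hG.isOpen hy (hs m k j) l]
  simp only [fun a => hs a l j y hy, fun a => hs a l k y hy, fun a => hs a k j y hy]
  ring

theorem riemann_cyclic (hG : IsMetricOn G S) (hy : y ∈ S) (j k l m : Fin n) :
    riemann G y j k l m + riemann G y k l j m + riemann G y l j k m = 0 := by
  simp only [riemann, ← Finset.sum_add_distrib, ← add_mul, hG.riemannUp_cyclic hy]
  simp

/-- The classical octahedron argument: a linear consequence of four cyclic identities and the two
antisymmetries. -/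
theorem riemann_pair_symm (hG : IsMetricOn G S) (hy : y ∈ S) (j k l m : Fin n) :
    riemann G y l m j k = riemann G y j k l m := by
  have a := fun a b c d => riemann_antisymm_left (G := G) (y := y) a b c d
  have b := hG.riemann_antisymm_right hy
  have c := hG.riemann_cyclic hy
  linarith [c j k l m, c k l m j, c l m j k, c m j k l, a j k l m, a j l k m, a j m k l,
    a k l j m, a k m j l, a l m j k, a j k m l, a j l m k, a j m l k, a k l m j, a k m l j,
    a l m k j, b j k l m, b j l k m, b j m k l, b k l j m, b k m j l, b l m j k,
    b k j l m, b l j k m, b m j k l, b l k j m, b m k j l, b m l j k]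

theorem ricci_eq (hG : IsMetricOn G S) (hy : y ∈ S) (k l : Fin n) :
    ricci G y k l = -∑ m, ∑ p, ginv G y m p * riemann G y m k l p := by
  unfold ricci riemann
  congr 1
  refine Finset.sum_congr rfl fun m _ => ?_
  simp_rw [Finset.mul_sum]
  rw [Finset.sum_comm]
  have : ∀ q, ∑ p, ginv G y m p * (riemannUp G y m k l q * G y q p)
      = riemannUp G y m k l q * if m = q then 1 else 0 := fun q => by
    rw [← hG.sum_ginv_mul_metric hy, Finset.mul_sum]
    refine Finset.sum_congr rfl fun p _ => ?_
    rw [hG.symm y hy q p]; ring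
  simp [this]

theorem ricci_symm (hG : IsMetricOn G S) (hy : y ∈ S) (k l : Fin n) :
    ricci G y k l = ricci G y l k := by
  rw [hG.ricci_eq hy, hG.ricci_eq hy, Finset.sum_comm]
  congr 1
  refine Finset.sum_congr rfl fun m _ => Finset.sum_congr rfl fun p _ => ?_
  rw [hG.ginv_symm hy p m, ← hG.riemann_pair_symm hy p k l m, riemann_antisymm_left m l,
    hG.riemann_antisymm_right hy m l k p]
  ring

theorem weyl_antisymm_right (hG : IsMetricOn G S) (hy : y ∈ S) (j k l m : Fin n) :
    weyl G y j k m l = -weyl G y j k l m := by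
  simp only [weyl]
  rw [hG.riemann_antisymm_right hy]
  ring

theorem weyl_pair_symm (hG : IsMetricOn G S) (hy : y ∈ S) (j k l m : Fin n) :
    weyl G y l m j k = weyl G y j k l m := by
  simp only [weyl]
  rw [hG.riemann_pair_symm hy, hG.symm y hy l k, hG.symm y hy m j, hG.symm y hy m k,
    hG.symm y hy l j, hG.ricci_symm hy l k, hG.ricci_symm hy m j, hG.ricci_symm hy m k,
    hG.ricci_symm hy l j]
  ring

theorem sum_ginv_mul_metric_eq (hG : IsMetricOn G S) (hy : y ∈ S) :
    ∑ j, ∑ m, ginv G y j m * G y j m = n := by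
  have : ∀ j, ∑ m, ginv G y j m * G y j m = 1 := fun j => by
    have h := hG.sum_ginv_mul_metric hy j j
    rw [if_pos rfl] at h
    rw [← h]
    exact Finset.sum_congr rfl fun m _ => by rw [hG.symm y hy j m]
  simp [this]

/-- Raising and lowering an index of a covector cancel. -/
theorem sum_ginv_mul_metric_mul (hG : IsMetricOn G S) (hy : y ∈ S) (v : Fin n → ℝ) (l : Fin n) :
    ∑ j, ∑ m, ginv G y j m * (G y l m * v j) = v l := by
  have : ∀ j, ∑ m, ginv G y j m * (G y l m * v j) = (if j = l then 1 else 0) * v j := fun j => by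
    rw [← hG.sum_ginv_mul_metric hy, Finset.sum_mul]
    refine Finset.sum_congr rfl fun m _ => ?_
    rw [hG.symm y hy l m]; ring
  simp [this]

theorem sum_ginv_swap (hG : IsMetricOn G S) (hy : y ∈ S) (T : Fin n → Fin n → ℝ) :
    ∑ j, ∑ m, ginv G y j m * T j m = ∑ j, ∑ m, ginv G y j m * T m j := by
  rw [Finset.sum_comm]
  exact Finset.sum_congr rfl fun j _ => Finset.sum_congr rfl fun m _ => by
    rw [hG.ginv_symm hy]

theorem sum_ginv_antisymm (hG : IsMetricOn G S) (hy : y ∈ S) (T : Fin n → Fin n → ℝ)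
    (hT : ∀ j m, T m j = -T j m) : ∑ j, ∑ m, ginv G y j m * T j m = 0 := by
  have h : ∑ j, ∑ m, ginv G y j m * T m j = -∑ j, ∑ m, ginv G y j m * T j m := by
    simp only [← Finset.sum_neg_distrib, ← mul_neg]
    exact Finset.sum_congr rfl fun j _ => Finset.sum_congr rfl fun m _ => by rw [hT j m]
  linarith [hG.sum_ginv_swap hy T]

/-- The Riemann term contributes -R_{kl}; the factors 1/(n-2) and 1/((n-1)(n-2)) in the Weyl tensor
are those that cancel it together with the scalar curvature terms. -/
theorem weyl_trace (hn : 3 < n) (hG : IsMetricOn G S) (hy : y ∈ S) (k l : Fin n) :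
    ∑ j, ∑ m, ginv G y j m * weyl G y j k l m = 0 := by
  have e1 := hG.ricci_eq hy k l
  have e2 := hG.sum_ginv_mul_metric_eq hy
  have e3 := hG.sum_ginv_mul_metric_mul hy (fun j => ricci G y j l) k
  have e4 := hG.sum_ginv_mul_metric_mul hy (fun j => G y j l) k
  have e5 := hG.sum_ginv_mul_metric_mul hy (fun j => ricci G y k j) l
  rw [hG.sum_ginv_swap hy] at e5
  have e6 : ∑ j, ∑ m, ginv G y j m * ricci G y j m = scalarCurv G y := rfl
  set c := 1 / ((n : ℝ) - 2)
  set d := scalarCurv G y / (((n : ℝ) - 1) * ((n : ℝ) - 2)) with hd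
  have key : ∀ j m, ginv G y j m * weyl G y j k l m = ginv G y j m * riemann G y j k l m
      + c * ricci G y k l * (ginv G y j m * G y j m)
      - c * (ginv G y j m * (G y k m * ricci G y j l))
      + c * G y k l * (ginv G y j m * ricci G y j m)
      - c * (ginv G y j m * (G y l j * ricci G y k m))
      - d * G y k l * (ginv G y j m * G y j m)
      + d * (ginv G y j m * (G y k m * G y j l)) := fun j m => by
    simp only [weyl]
    rw [hG.symm y hy l j]
    ring
  simp only [key, Finset.sum_add_distrib, Finset.sum_sub_distrib, ← Finset.mul_sum]
  rw [e2, e3, e4, e5, e6]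
  have h3 : (3 : ℝ) < n := by exact_mod_cast hn
  have h1 : (n : ℝ) - 1 ≠ 0 := by linarith
  have h2 : (n : ℝ) - 2 ≠ 0 := by linarith
  have e1' : ∑ j, ∑ m, ginv G y j m * riemann G y j k l m = -ricci G y k l := by linarith
  rw [e1', hd]
  simp only [c]
  field_simp
  ring

end IsMetricOn

end

/-! ### Torse-forming fields and the contraction of the curvature with u. -/

section

/-- On `S` the vector field `u` is unit time-like and `∇_i u_j = φ (g_{ij} + u_i u_j)`. -/
structure IsTorseFormingOn {n : ℕ} (G : EuclideanSpace ℝ (Fin n) → Matrix (Fin n) (Fin n) ℝ)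
    (S : Set (EuclideanSpace ℝ (Fin n))) (u : EuclideanSpace ℝ (Fin n) → Fin n → ℝ)
    (φ : EuclideanSpace ℝ (Fin n) → ℝ) : Prop where
  smooth : ∀ i, ContDiffOn ℝ ∞ (fun y => u y i) S
  unit : ∀ y ∈ S, ∑ i, u y i * lower G u y i = -1
  nabla : ∀ y ∈ S, ∀ i j, nabla1 G (lower G u) y i j
    = φ y * (G y i j + lower G u y i * lower G u y j)

namespace IsTorseFormingOn

variable {n : ℕ} {G : EuclideanSpace ℝ (Fin n) → Matrix (Fin n) (Fin n) ℝ}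
  {S : Set (EuclideanSpace ℝ (Fin n))} {y : EuclideanSpace ℝ (Fin n)}
  {u : EuclideanSpace ℝ (Fin n) → Fin n → ℝ} {φ : EuclideanSpace ℝ (Fin n) → ℝ}

theorem contDiffOn_lower (hu : IsTorseFormingOn G S u φ) (hG : IsMetricOn G S) (j : Fin n) :
    ContDiffOn ℝ ∞ (fun y => lower G u y j) S := by
  unfold lower
  exact ContDiffOn.sum fun k _ => (hG.smooth j k).mul (hu.smooth k)

theorem _root_.Spacetime.IsMetricOn.sum_ginv_mul_lower (hG : IsMetricOn G S) (hy : y ∈ S)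
    (i : Fin n) : ∑ j, ginv G y i j * lower G u y j = u y i := by
  simp only [lower, Finset.mul_sum]
  rw [Finset.sum_comm]
  simp only [← mul_assoc, ← Finset.sum_mul, hG.sum_ginv_mul_metric hy]
  simp

theorem _root_.Spacetime.IsMetricOn.sum_sum_ginv_mul_lower (hG : IsMetricOn G S) (hy : y ∈ S)
    (v : Fin n → ℝ) :
    ∑ p, ∑ q, ginv G y p q * (v p * lower G u y q) = ∑ p, u y p * v p := by
  refine Finset.sum_congr rfl fun p _ => ?_
  rw [← hG.sum_ginv_mul_lower (u := u) hy p, Finset.sum_mul]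
  exact Finset.sum_congr rfl fun q _ => by ring

theorem sum_ginv_mul_projection (hu : IsTorseFormingOn G S u φ) (hG : IsMetricOn G S)
    (hy : y ∈ S) :
    ∑ i, ∑ j, ginv G y i j * (G y i j + lower G u y i * lower G u y j) = (n : ℝ) - 1 := by
  simp only [mul_add, Finset.sum_add_distrib]
  rw [hG.sum_ginv_mul_metric_eq hy, hG.sum_sum_ginv_mul_lower hy, hu.unit y hy]
  ring

/-- Smoothness of φ is not part of the hypotheses: it follows from (n-1)φ = g^{ij}∇_i u_j. -/
theorem contDiffOn_scale (hn : 3 < n) (hu : IsTorseFormingOn G S u φ) (hG : IsMetricOn G S) :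
    ContDiffOn ℝ ∞ φ S := by
  have h : ∀ z ∈ S, φ z = (∑ i, ∑ j, ginv G z i j * nabla1 G (lower G u) z i j)
      / ((n : ℝ) - 1) := fun z hz => by
    have h3 : (3 : ℝ) < n := by exact_mod_cast hn
    have h1 : (n : ℝ) - 1 ≠ 0 := by linarith
    rw [eq_div_iff h1, ← hu.sum_ginv_mul_projection hG hz]
    simp only [hu.nabla z hz, Finset.mul_sum]
    exact Finset.sum_congr rfl fun i _ => Finset.sum_congr rfl fun j _ => by ring
  refine ContDiffOn.congr ?_ h
  unfold nabla1
  exact (ContDiffOn.sum fun i _ => ContDiffOn.sum fun j _ => (hG.contDiffOn_ginv i j).mul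
    ((contDiffOn_pd hG.isOpen (hu.contDiffOn_lower hG j) i).sub
      (ContDiffOn.sum fun q _ => (hG.contDiffOn_christoffel q i j).mul
        (hu.contDiffOn_lower hG q)))).div_const _

theorem pd_lower (hu : IsTorseFormingOn G S u φ) (hy : y ∈ S) (i j : Fin n) :
    pd i (fun z => lower G u z j) y = φ y * (G y i j + lower G u y i * lower G u y j)
      + ∑ q, christoffel G y q i j * lower G u y q := by
  have := hu.nabla y hy i j
  rw [nabla1] at this
  linarith

/-- The covector `∂_j φ - φ² u_j`. -/
def _root_.Spacetime.torseCovector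
    (G : EuclideanSpace ℝ (Fin n) → Matrix (Fin n) (Fin n) ℝ)
    (u : EuclideanSpace ℝ (Fin n) → Fin n → ℝ) (φ : EuclideanSpace ℝ (Fin n) → ℝ)
    (y : EuclideanSpace ℝ (Fin n)) (j : Fin n) : ℝ :=
  pd j φ y - φ y ^ 2 * lower G u y j

theorem pd_pd_lower (hn : 3 < n) (hu : IsTorseFormingOn G S u φ) (hG : IsMetricOn G S)
    (hy : y ∈ S) (j k l : Fin n) :
    pd j (pd k (fun z => lower G u z l)) y
      = pd j φ y * (G y k l + lower G u y k * lower G u y l)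
        + φ y * (pd j (fun z => G z k l) y + (pd j (fun z => lower G u z k) y * lower G u y l
          + lower G u y k * pd j (fun z => lower G u z l) y))
        + ∑ q, (pd j (fun z => christoffel G z q k l) y * lower G u y q
          + christoffel G y q k l * pd j (fun z => lower G u z q) y) := by
  have d : ∀ {F : EuclideanSpace ℝ (Fin n) → ℝ}, ContDiffOn ℝ ∞ F S → DifferentiableAt ℝ F y :=
    fun hF => differentiableAt_of_smooth hG.isOpen hy hF
  have hφ := d (hu.contDiffOn_scale hn hG)
  have hw := fun a => d (hu.contDiffOn_lower hG a)
  have hg := d (hG.smooth k l)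
  have hc := fun q => d (hG.contDiffOn_christoffel q k l)
  rw [pd_congr hG.isOpen hy (fun z hz => hu.pd_lower hz k l),
    pd_add (hφ.fun_mul (hg.fun_add ((hw k).fun_mul (hw l))))
      (DifferentiableAt.fun_sum fun q _ => (hc q).fun_mul (hw q)),
    pd_mul hφ (hg.fun_add ((hw k).fun_mul (hw l))), pd_add hg ((hw k).fun_mul (hw l)),
    pd_mul (hw k) (hw l), pd_sum fun q _ => (hc q).fun_mul (hw q)]
  congr 1
  exact Finset.sum_congr rfl fun q _ => pd_mul (hc q) (hw q) j

/-- The Ricci identity for u, obtained from the symmetry of the second partials of u_l. Substituting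
∇u = φh turns the commutator into derivatives of φ plus the terms φ²(u_k h_{jl} - u_j h_{kl}), which
`torseCovector` absorbs. -/
theorem sum_riemannUp_mul_lower (hn : 3 < n) (hu : IsTorseFormingOn G S u φ)
    (hG : IsMetricOn G S) (hy : y ∈ S) (j k l : Fin n) :
    ∑ m, riemannUp G y j k l m * lower G u y m
      = torseCovector G u φ y j * (G y k l + lower G u y k * lower G u y l)
        - torseCovector G u φ y k * (G y j l + lower G u y j * lower G u y l) := by
  have hcomm := pd_comm hG.isOpen hy (hu.contDiffOn_lower hG l) j k
  rw [hu.pd_pd_lower hn hG hy, hu.pd_pd_lower hn hG hy] at hcomm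
  simp only [hu.pd_lower hy, hG.pd_metric hy] at hcomm
  have hR : ∑ m, riemannUp G y j k l m * lower G u y m
      = ∑ m, pd k (fun z => christoffel G z m j l) y * lower G u y m
        - ∑ m, pd j (fun z => christoffel G z m k l) y * lower G u y m
        + ∑ q, christoffel G y q j l * ∑ m, christoffel G y m k q * lower G u y m
        - ∑ q, christoffel G y q k l * ∑ m, christoffel G y m j q * lower G u y m := by
    have e : ∀ a b : Fin n,
        ∑ q, christoffel G y q a l * ∑ m, christoffel G y m b q * lower G u y m
        = ∑ m, (∑ q, christoffel G y q a l * christoffel G y m b q) * lower G u y m := by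
      intro a b
      simp only [Finset.mul_sum, Finset.sum_mul]
      rw [Finset.sum_comm]
      exact Finset.sum_congr rfl fun m _ => Finset.sum_congr rfl fun q _ => by ring
    rw [e, e, ← Finset.sum_sub_distrib, ← Finset.sum_add_distrib, ← Finset.sum_sub_distrib]
    refine Finset.sum_congr rfl fun m _ => ?_
    simp only [riemannUp, Finset.sum_sub_distrib]
    ring
  have hS : ∀ a b : Fin n, ∑ q, christoffel G y q a l * (φ y * (G y b q
        + lower G u y b * lower G u y q)) = φ y * ∑ q, christoffel G y q a l * G y b q
        + φ y * lower G u y b * ∑ q, christoffel G y q a l * lower G u y q := by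
    intro a b
    rw [Finset.mul_sum, Finset.mul_sum, ← Finset.sum_add_distrib]
    exact Finset.sum_congr rfl fun q _ => by ring
  simp only [mul_add (christoffel G y _ _ l), Finset.sum_add_distrib, hS] at hcomm
  have s1 : ∑ q, christoffel G y q k j * lower G u y q
      = ∑ q, christoffel G y q j k * lower G u y q :=
    Finset.sum_congr rfl fun q _ => by rw [hG.christoffel_symm hy]
  have s2 : ∑ q, christoffel G y q k j * G y q l = ∑ q, christoffel G y q j k * G y q l :=
    Finset.sum_congr rfl fun q _ => by rw [hG.christoffel_symm hy]
  rw [s1, s2, hG.symm y hy k j] at hcomm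
  rw [hR]
  simp only [torseCovector]
  linear_combination -hcomm

theorem sum_mul_riemann (hn : 3 < n) (hu : IsTorseFormingOn G S u φ)
    (hG : IsMetricOn G S) (hy : y ∈ S) (j k l : Fin n) :
    ∑ m, u y m * riemann G y j k l m
      = torseCovector G u φ y j * (G y k l + lower G u y k * lower G u y l)
        - torseCovector G u φ y k * (G y j l + lower G u y j * lower G u y l) := by
  rw [← hu.sum_riemannUp_mul_lower hn hG hy]
  simp only [riemann, lower, Finset.mul_sum]
  rw [Finset.sum_comm]
  exact Finset.sum_congr rfl fun p _ => Finset.sum_congr rfl fun m _ => by ring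

/-- Trace of `sum_mul_riemann`. The coefficient -(n-2) is 1 - (n-1), with n-1 the trace of h; it is
what later cancels the factor 1/(n-2) in the Weyl tensor. -/
theorem sum_mul_ricci (hn : 3 < n) (hu : IsTorseFormingOn G S u φ)
    (hG : IsMetricOn G S) (hy : y ∈ S) (k : Fin n) :
    ∑ m, u y m * ricci G y k m = -((n : ℝ) - 2) * torseCovector G u φ y k
      + (∑ p, u y p * torseCovector G u φ y p) * lower G u y k := by
  set a := torseCovector G u φ y with ha
  have h1 : ∑ m, u y m * ricci G y k m
      = ∑ p, ∑ q, ginv G y p q * ∑ m, u y m * riemann G y p k q m := by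
    have e : ∀ m, u y m * ricci G y k m
        = ∑ p, ∑ q, ginv G y p q * (u y m * riemann G y p k q m) := fun m => by
      rw [hG.ricci_eq hy, ← Finset.sum_neg_distrib, Finset.mul_sum]
      refine Finset.sum_congr rfl fun p _ => ?_
      rw [← Finset.sum_neg_distrib, Finset.mul_sum]
      refine Finset.sum_congr rfl fun q _ => ?_
      rw [hG.riemann_antisymm_right hy p k q m]
      ring
    simp only [e, Finset.mul_sum]
    rw [Finset.sum_comm]
    exact Finset.sum_congr rfl fun p _ => Finset.sum_comm
  have h2 : ∀ p q, ginv G y p q * ∑ m, u y m * riemann G y p k q m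
      = ginv G y p q * (G y k q * a p) + lower G u y k * (ginv G y p q * (a p * lower G u y q))
        - a k * (ginv G y p q * (G y p q + lower G u y p * lower G u y q)) := fun p q => by
    rw [hu.sum_mul_riemann hn hG hy]
    ring
  rw [h1]
  simp only [h2, Finset.sum_sub_distrib, Finset.sum_add_distrib, ← Finset.mul_sum]
  rw [hG.sum_ginv_mul_metric_mul hy, hG.sum_sum_ginv_mul_lower hy,
    hu.sum_ginv_mul_projection hG hy]
  ring

theorem exists_sum_mul_weyl (hn : 3 < n) (hu : IsTorseFormingOn G S u φ)
    (hG : IsMetricOn G S) (hy : y ∈ S) : ∃ X : Fin n → Fin n → ℝ, ∀ j k l,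
    ∑ m, u y m * weyl G y j k l m = lower G u y j * X k l - lower G u y k * X j l := by
  set a := torseCovector G u φ y with ha
  set α := ∑ p, u y p * a p with hα
  -- X collects the coefficient of u_j. Its last term comes from the part a_j u_k u_l - a_k u_j u_l
  -- of the Riemann contraction.
  refine ⟨fun k l => 1 / ((n : ℝ) - 2) * (ricci G y k l + α * G y k l)
    - scalarCurv G y / (((n : ℝ) - 1) * ((n : ℝ) - 2)) * G y k l
    - a k * lower G u y l, fun j k l => ?_⟩
  have hl : ∀ j, ∑ m, u y m * G y j m = lower G u y j := fun j =>
    Finset.sum_congr rfl fun m _ => mul_comm _ _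
  have h1 : ∑ m, u y m * weyl G y j k l m = ∑ m, u y m * riemann G y j k l m
      + 1 / ((n : ℝ) - 2) * ((∑ m, u y m * G y j m) * ricci G y k l
        - (∑ m, u y m * G y k m) * ricci G y j l + (∑ m, u y m * ricci G y j m) * G y k l
        - (∑ m, u y m * ricci G y k m) * G y j l)
      - scalarCurv G y / (((n : ℝ) - 1) * ((n : ℝ) - 2))
        * ((∑ m, u y m * G y j m) * G y k l - (∑ m, u y m * G y k m) * G y j l) := by
    simp only [Finset.sum_mul, Finset.mul_sum, ← Finset.sum_sub_distrib,
      ← Finset.sum_add_distrib]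
    exact Finset.sum_congr rfl fun m _ => by simp only [weyl]; ring
  rw [h1, hl, hl, hu.sum_mul_riemann hn hG hy, hu.sum_mul_ricci hn hG hy,
    hu.sum_mul_ricci hn hG hy, ← ha, ← hα]
  have h3 : (3 : ℝ) < n := by exact_mod_cast hn
  have h2 : (n : ℝ) - 2 ≠ 0 := by linarith
  -- The only terms free of u_j and u_k are a_j g_{kl} - a_k g_{jl}; the Ricci contribution removes
  -- them.
  have hc : 1 / ((n : ℝ) - 2) * ((n : ℝ) - 2) = 1 := by field_simp
  linear_combination (-a j * G y k l + a k * G y j l) * hc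

/-- The contraction `u^m C_{jklm}` is determined by the electric part. -/
theorem sum_mul_weyl (hn : 3 < n) (hu : IsTorseFormingOn G S u φ)
    (hG : IsMetricOn G S) (hy : y ∈ S) (j k l : Fin n) :
    ∑ m, u y m * weyl G y j k l m
      = lower G u y k * electric G u y j l - lower G u y j * electric G u y k l := by
  obtain ⟨X, hX⟩ := hu.exists_sum_mul_weyl hn hG hy
  -- Contracting with u^j and using u·u = -1 gives E = -X up to a term u_k Y_l, which drops out
  -- after antisymmetrising with u_j.
  have hE : ∀ k l, electric G u y k l = -X k l - lower G u y k * ∑ j, u y j * X j l := by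
    intro k l
    have : electric G u y k l = ∑ j, u y j * ∑ m, u y m * weyl G y j k l m := by
      simp only [electric, Finset.mul_sum, mul_assoc]
    rw [this]
    simp only [hX, mul_sub, Finset.sum_sub_distrib, ← mul_assoc, ← Finset.sum_mul,
      hu.unit y hy]
    rw [Finset.mul_sum]
    simp only [← mul_assoc, mul_comm (u y _) (lower G u y k)]
    ring
  rw [hX, hE, hE]
  ring

end IsTorseFormingOn

end

/-! ### Covariant derivatives of the contracted Weyl tensor and of E. -/

section

/-- The covariant derivative `∇_i T_{jkl}`. -/
def nabla3 {n : ℕ} (G : EuclideanSpace ℝ (Fin n) → Matrix (Fin n) (Fin n) ℝ)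
    (T : EuclideanSpace ℝ (Fin n) → Fin n → Fin n → Fin n → ℝ)
    (y : EuclideanSpace ℝ (Fin n)) (i j k l : Fin n) : ℝ :=
  pd i (fun z => T z j k l) y
    - ∑ q, christoffel G y q i j * T y q k l
    - ∑ q, christoffel G y q i k * T y j q l
    - ∑ q, christoffel G y q i l * T y j k q

/-- The contraction `u^j C_{jklm}`. -/
def weylVec {n : ℕ} (G : EuclideanSpace ℝ (Fin n) → Matrix (Fin n) (Fin n) ℝ)
    (u : EuclideanSpace ℝ (Fin n) → Fin n → ℝ)
    (y : EuclideanSpace ℝ (Fin n)) (k l m : Fin n) : ℝ :=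
  ∑ j, u y j * weyl G y j k l m

variable {n : ℕ} {G : EuclideanSpace ℝ (Fin n) → Matrix (Fin n) (Fin n) ℝ}
  {S : Set (EuclideanSpace ℝ (Fin n))} {y : EuclideanSpace ℝ (Fin n)}
  {u : EuclideanSpace ℝ (Fin n) → Fin n → ℝ} {φ : EuclideanSpace ℝ (Fin n) → ℝ}

theorem electric_eq_sum_weylVec (k l : Fin n) :
    electric G u y k l = ∑ m, u y m * weylVec G u y k l m := by
  simp only [electric, weylVec, Finset.mul_sum]
  rw [Finset.sum_comm]
  exact Finset.sum_congr rfl fun m _ => Finset.sum_congr rfl fun j _ => by ring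

theorem sum_mul_mul_antisymm (v : Fin n → ℝ) (T : Fin n → Fin n → ℝ)
    (hT : ∀ j m, T m j = -T j m) : ∑ j, v j * ∑ m, v m * T j m = 0 := by
  simp only [Finset.mul_sum]
  have h : ∑ j, ∑ m, v j * (v m * T j m) = -∑ j, ∑ m, v j * (v m * T j m) := by
    conv_lhs => rw [Finset.sum_comm]
    simp only [← Finset.sum_neg_distrib]
    exact Finset.sum_congr rfl fun j _ => Finset.sum_congr rfl fun m _ => by
      rw [hT j m]; ring
  linarith

namespace IsMetricOn

theorem weylVec_antisymm (hG : IsMetricOn G S) (hy : y ∈ S) (k l m : Fin n) :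
    weylVec G u y k m l = -weylVec G u y k l m := by
  simp only [weylVec, ← Finset.sum_neg_distrib]
  exact Finset.sum_congr rfl fun j _ => by rw [hG.weyl_antisymm_right hy j k l m]; ring

theorem electric_symm (hG : IsMetricOn G S) (hy : y ∈ S) (k l : Fin n) :
    electric G u y k l = electric G u y l k := by
  simp only [electric]
  rw [Finset.sum_comm]
  refine Finset.sum_congr rfl fun m _ => Finset.sum_congr rfl fun j _ => ?_
  rw [← hG.weyl_pair_symm hy m l k j, hG.weyl_antisymm_right hy k j l m,
    weyl_antisymm_left j k]
  ring

theorem sum_mul_electric (hG : IsMetricOn G S) (hy : y ∈ S) (k : Fin n) :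
    ∑ l, u y l * electric G u y k l = 0 := by
  simp only [electric_eq_sum_weylVec]
  exact sum_mul_mul_antisymm (u y) (weylVec G u y k) (hG.weylVec_antisymm hy k)

theorem nabla4_weyl_antisymm (hG : IsMetricOn G S) (hy : y ∈ S) (p j k l m : Fin n) :
    nabla4 G (weyl G) y p j k m l = -nabla4 G (weyl G) y p j k l m := by
  have h := fun a b c d z hz => hG.weyl_antisymm_right (y := z) hz a b c d
  simp only [nabla4]
  rw [pd_congr hG.isOpen hy (h j k l m), pd_neg]
  simp only [fun a b c => h a b l c y hy, fun a b c => h a b c m y hy, mul_neg,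
    Finset.sum_neg_distrib]
  ring

theorem nabla2_electric_symm (hG : IsMetricOn G S) (hy : y ∈ S) (p k l : Fin n) :
    nabla2 G (electric G u) y p k l = nabla2 G (electric G u) y p l k := by
  have h := fun a b z hz => hG.electric_symm (u := u) (y := z) hz a b
  simp only [nabla2]
  rw [pd_congr hG.isOpen hy (h k l)]
  simp only [fun a => h a l y hy, fun a => h k a y hy]
  ring

theorem sum_ginv_nabla4_weyl (hG : IsMetricOn G S) (hy : y ∈ S) (j k l : Fin n) :
    ∑ p, ∑ m, ginv G y p m * nabla4 G (weyl G) y p j k l m = divWeyl G y j k l := by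
  rw [hG.sum_ginv_swap hy]
  rfl

end IsMetricOn

namespace IsTorseFormingOn

theorem contDiffOn_weylVec (hu : IsTorseFormingOn G S u φ) (hG : IsMetricOn G S)
    (k l m : Fin n) : ContDiffOn ℝ ∞ (fun z => weylVec G u z k l m) S := by
  unfold weylVec
  exact ContDiffOn.sum fun j _ => (hu.smooth j).mul (hG.contDiffOn_weyl j k l m)

theorem contDiffOn_electric (hu : IsTorseFormingOn G S u φ) (hG : IsMetricOn G S)
    (k l : Fin n) : ContDiffOn ℝ ∞ (fun z => electric G u z k l) S := by
  simp only [electric_eq_sum_weylVec]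
  exact ContDiffOn.sum fun m _ => (hu.smooth m).mul (hu.contDiffOn_weylVec hG k l m)

/-- The covariant derivative of `u` with the index up: `∇_p u^j = φ (δ_p^j + u_p u^j)`. -/
theorem pd_vec (hu : IsTorseFormingOn G S u φ) (hG : IsMetricOn G S) (hy : y ∈ S)
    (p i : Fin n) :
    pd p (fun z => u z i) y = φ y * ((if i = p then 1 else 0) + lower G u y p * u y i)
      - ∑ q, christoffel G y i p q * u y q := by
  have d : ∀ {F : EuclideanSpace ℝ (Fin n) → ℝ}, ContDiffOn ℝ ∞ F S → DifferentiableAt ℝ F y :=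
    fun hF => differentiableAt_of_smooth hG.isOpen hy hF
  -- The defect in the claimed formula. Lowering its index gives zero, by the equation for u_j and
  -- ∇g = 0, so it vanishes since g is invertible.
  set v : Fin n → ℝ := fun k => pd p (fun z => u z k) y + ∑ q, christoffel G y k p q * u y q
    - φ y * ((if k = p then 1 else 0) + lower G u y p * u y k) with hv
  have hzero : ∀ j, ∑ k, G y j k * v k = 0 := by
    intro j
    have h1 := hu.pd_lower hy p j
    have h2 : pd p (fun z => lower G u z j) y
        = ∑ k, pd p (fun z => G z j k) y * u y k + ∑ k, G y j k * pd p (fun z => u z k) y := by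
      unfold lower
      rw [pd_sum fun k _ => (d (hG.smooth j k)).fun_mul (d (hu.smooth k)),
        ← Finset.sum_add_distrib]
      exact Finset.sum_congr rfl fun k _ => pd_mul (d (hG.smooth j k)) (d (hu.smooth k)) p
    have h3 : ∑ k, pd p (fun z => G z j k) y * u y k
        = ∑ q, christoffel G y q p j * lower G u y q
          + ∑ k, G y j k * ∑ q, christoffel G y k p q * u y q := by
      simp only [hG.pd_metric hy, add_mul, Finset.sum_add_distrib, lower, Finset.mul_sum,
        Finset.sum_mul]
      congr 1
      · rw [Finset.sum_comm]
        exact Finset.sum_congr rfl fun k _ => Finset.sum_congr rfl fun q _ => by ring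
      · rw [Finset.sum_comm]
        exact Finset.sum_congr rfl fun k _ => Finset.sum_congr rfl fun q _ => by ring
    have h4 : ∑ k, G y j k * (φ y * ((if k = p then 1 else 0) + lower G u y p * u y k))
        = φ y * (G y p j + lower G u y p * lower G u y j) := by
      have : ∀ k, G y j k * (φ y * ((if k = p then 1 else 0) + lower G u y p * u y k))
          = φ y * (if k = p then G y j k else 0)
            + φ y * lower G u y p * (G y j k * u y k) := fun k => by
        split_ifs <;> ring
      simp only [this, Finset.sum_add_distrib, ← Finset.mul_sum]
      rw [hG.symm y hy p j]
      simp only [Finset.sum_ite_eq', Finset.mem_univ, if_true]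
      simp only [lower]
      ring
    simp only [hv, mul_sub, mul_add, Finset.sum_sub_distrib, Finset.sum_add_distrib]
    simp only [mul_add, Finset.sum_add_distrib] at h4
    linarith
  have hvi : v i = 0 := by
    have : ∑ j, ginv G y i j * ∑ k, G y j k * v k = v i := by
      simp only [Finset.mul_sum]
      rw [Finset.sum_comm]
      simp only [← mul_assoc, ← Finset.sum_mul, hG.sum_ginv_mul_metric hy]
      simp
    rw [← this]
    simp [hzero]
  simp only [hv] at hvi
  linarith

/-- The Leibniz rule for the contraction of `u` with one index of a tensor, the connection
terms of the other indices being left out. -/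
theorem pd_contract (hu : IsTorseFormingOn G S u φ) (hG : IsMetricOn G S) (hy : y ∈ S)
    {T : EuclideanSpace ℝ (Fin n) → Fin n → ℝ} (hT : ∀ j, ContDiffOn ℝ ∞ (fun z => T z j) S)
    (p : Fin n) :
    pd p (fun z => ∑ j, u z j * T z j) y
      = φ y * (T y p + lower G u y p * ∑ j, u y j * T y j)
        + ∑ j, u y j * (pd p (fun z => T z j) y - ∑ q, christoffel G y q p j * T y q) := by
  have d : ∀ {F : EuclideanSpace ℝ (Fin n) → ℝ}, ContDiffOn ℝ ∞ F S → DifferentiableAt ℝ F y :=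
    fun hF => differentiableAt_of_smooth hG.isOpen hy hF
  have h1 : ∑ j, (∑ q, christoffel G y j p q * u y q) * T y j
      = ∑ j, u y j * ∑ q, christoffel G y q p j * T y q := by
    simp only [Finset.mul_sum, Finset.sum_mul]
    rw [Finset.sum_comm]
    exact Finset.sum_congr rfl fun k _ => Finset.sum_congr rfl fun q _ => by ring
  have h2 : ∑ j, φ y * ((if j = p then 1 else 0) + lower G u y p * u y j) * T y j
      = φ y * (T y p + lower G u y p * ∑ j, u y j * T y j) := by
    have : ∀ j, φ y * ((if j = p then 1 else 0) + lower G u y p * u y j) * T y j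
        = φ y * (if j = p then T y j else 0) + φ y * lower G u y p * (u y j * T y j) := fun j => by
      split_ifs <;> ring
    simp only [this, Finset.sum_add_distrib, ← Finset.mul_sum, Finset.sum_ite_eq',
      Finset.mem_univ, if_true]
    ring
  rw [pd_sum fun j _ => (d (hu.smooth j)).fun_mul (d (hT j))]
  simp only [fun j => pd_mul (d (hu.smooth j)) (d (hT j)) p, hu.pd_vec hG hy, sub_mul, mul_sub,
    Finset.sum_add_distrib, Finset.sum_sub_distrib]
  rw [h1, h2]
  ring

theorem _root_.Spacetime.sum_mul_sum_comm (c v : Fin n → ℝ) (T : Fin n → Fin n → ℝ) :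
    ∑ q, c q * ∑ j, v j * T q j = ∑ j, v j * ∑ q, c q * T q j := by
  simp only [Finset.mul_sum]
  rw [Finset.sum_comm]
  exact Finset.sum_congr rfl fun k _ => Finset.sum_congr rfl fun q _ => by ring

/-- Leibniz rule for u^j C_{jklm}. The connection terms of the free indices commute with the
contraction, so `pd_contract` suffices. -/
theorem nabla3_weylVec (hu : IsTorseFormingOn G S u φ) (hG : IsMetricOn G S) (hy : y ∈ S)
    (p k l m : Fin n) :
    nabla3 G (weylVec G u) y p k l m
      = φ y * (weyl G y p k l m + lower G u y p * weylVec G u y k l m)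
        + ∑ j, u y j * nabla4 G (weyl G) y p j k l m := by
  have h := hu.pd_contract hG hy (T := fun z j => weyl G z j k l m)
    (fun j => hG.contDiffOn_weyl j k l m) p
  simp only [nabla3, nabla4, weylVec]
  rw [h]
  simp only [fun c : Fin n → ℝ => sum_mul_sum_comm c (u y) (fun q j => weyl G y j q l m),
    fun c : Fin n → ℝ => sum_mul_sum_comm c (u y) (fun q j => weyl G y j k q m),
    fun c : Fin n → ℝ => sum_mul_sum_comm c (u y) (fun q j => weyl G y j k l q),
    mul_sub, Finset.sum_sub_distrib]
  ring

theorem nabla2_electric (hu : IsTorseFormingOn G S u φ) (hG : IsMetricOn G S) (hy : y ∈ S)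
    (p k l : Fin n) :
    nabla2 G (electric G u) y p k l
      = φ y * (weylVec G u y k l p + lower G u y p * electric G u y k l)
        + ∑ m, u y m * nabla3 G (weylVec G u) y p k l m := by
  have h := hu.pd_contract hG hy (T := fun z m => weylVec G u z k l m)
    (fun m => hu.contDiffOn_weylVec hG k l m) p
  simp only [nabla2, nabla3, electric_eq_sum_weylVec]
  rw [h]
  simp only [fun c : Fin n → ℝ => sum_mul_sum_comm c (u y) (fun q m => weylVec G u y q l m),
    fun c : Fin n → ℝ => sum_mul_sum_comm c (u y) (fun q m => weylVec G u y k q m),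
    mul_sub, Finset.sum_sub_distrib]
  ring

/-- The contraction `g^{pm} ∇_p (u^j C_{jklm})` for a divergence-free Weyl tensor. -/
theorem sum_ginv_nabla3_weylVec (hn : 3 < n) (hu : IsTorseFormingOn G S u φ)
    (hG : IsMetricOn G S) (hdiv : ∀ y ∈ S, ∀ j k l, divWeyl G y j k l = 0) (hy : y ∈ S)
    (k l : Fin n) :
    ∑ p, ∑ m, ginv G y p m * nabla3 G (weylVec G u) y p k l m = φ y * electric G u y k l := by
  have h4 : ∑ p, ∑ m, ginv G y p m * ∑ j, u y j * nabla4 G (weyl G) y p j k l m = 0 := by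
    have : ∑ p, ∑ m, ginv G y p m * ∑ j, u y j * nabla4 G (weyl G) y p j k l m
        = ∑ j, u y j * ∑ p, ∑ m, ginv G y p m * nabla4 G (weyl G) y p j k l m := by
      simp only [Finset.mul_sum]
      conv_rhs => rw [Finset.sum_comm]
      refine Finset.sum_congr rfl fun p _ => ?_
      conv_rhs => rw [Finset.sum_comm]
      exact Finset.sum_congr rfl fun m _ => Finset.sum_congr rfl fun j _ => by ring
    rw [this]
    simp [hG.sum_ginv_nabla4_weyl hy, hdiv y hy]
  have h1 : ∑ p, ∑ m, ginv G y p m * (lower G u y p * weylVec G u y k l m)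
      = electric G u y k l := by
    rw [electric_eq_sum_weylVec, ← hG.sum_sum_ginv_mul_lower (u := u) hy,
      hG.sum_ginv_swap hy (fun p q => weylVec G u y k l p * lower G u y q)]
    exact Finset.sum_congr rfl fun p _ => Finset.sum_congr rfl fun m _ => by ring
  simp only [hu.nabla3_weylVec hG hy]
  have e : ∀ p m, ginv G y p m * (φ y * (weyl G y p k l m + lower G u y p * weylVec G u y k l m)
      + ∑ j, u y j * nabla4 G (weyl G) y p j k l m)
      = φ y * (ginv G y p m * weyl G y p k l m)
        + φ y * (ginv G y p m * (lower G u y p * weylVec G u y k l m))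
        + ginv G y p m * ∑ j, u y j * nabla4 G (weyl G) y p j k l m := fun p m => by ring
  simp only [e, Finset.sum_add_distrib, ← Finset.mul_sum]
  rw [h4, h1, hG.weyl_trace hn hy]
  ring

theorem nabla3_weylVec_antisymm (hu : IsTorseFormingOn G S u φ)
    (hG : IsMetricOn G S) (hy : y ∈ S) (p k l m : Fin n) :
    nabla3 G (weylVec G u) y p k m l = -nabla3 G (weylVec G u) y p k l m := by
  rw [hu.nabla3_weylVec hG hy, hu.nabla3_weylVec hG hy, hG.weylVec_antisymm hy k l m,
    hG.weyl_antisymm_right hy p k l m]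
  simp only [hG.nabla4_weyl_antisymm hy p _ k l m, mul_neg, Finset.sum_neg_distrib]
  ring

/-- The divergence of the electric part vanishes. -/
theorem sum_ginv_nabla2_electric (hn : 3 < n) (hu : IsTorseFormingOn G S u φ)
    (hG : IsMetricOn G S) (hdiv : ∀ y ∈ S, ∀ j k l, divWeyl G y j k l = 0) (hy : y ∈ S)
    (k : Fin n) : ∑ p, ∑ l, ginv G y p l * nabla2 G (electric G u) y p k l = 0 := by
  have h1 := hG.sum_ginv_antisymm hy (fun p l => weylVec G u y k l p)
    (fun p l => hG.weylVec_antisymm hy k l p)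
  have h2 : ∑ p, ∑ l, ginv G y p l * (lower G u y p * electric G u y k l) = 0 := by
    rw [← hG.sum_mul_electric (u := u) hy k, ← hG.sum_sum_ginv_mul_lower (u := u) hy,
      hG.sum_ginv_swap hy (fun p q => electric G u y k p * lower G u y q)]
    exact Finset.sum_congr rfl fun p _ => Finset.sum_congr rfl fun m _ => by ring
  -- Antisymmetry moves the contracted index to the last slot, where the divergence is already known
  -- to be φE.
  have h3 : ∑ p, ∑ l, ginv G y p l * ∑ m, u y m * nabla3 G (weylVec G u) y p k l m
      = ∑ m, u y m * -∑ p, ∑ l, ginv G y p l * nabla3 G (weylVec G u) y p k m l := by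
    simp only [← Finset.sum_neg_distrib, Finset.mul_sum]
    conv_rhs => rw [Finset.sum_comm]
    refine Finset.sum_congr rfl fun p _ => ?_
    conv_rhs => rw [Finset.sum_comm]
    refine Finset.sum_congr rfl fun l _ => Finset.sum_congr rfl fun m _ => ?_
    rw [hu.nabla3_weylVec_antisymm hG hy p k l m]
    ring
  have e : ∀ p l, ginv G y p l * nabla2 G (electric G u) y p k l
      = φ y * (ginv G y p l * weylVec G u y k l p)
        + φ y * (ginv G y p l * (lower G u y p * electric G u y k l))
        + ginv G y p l * ∑ m, u y m * nabla3 G (weylVec G u) y p k l m := fun p l => by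
    rw [hu.nabla2_electric hG hy]; ring
  simp only [e, Finset.sum_add_distrib, ← Finset.mul_sum]
  rw [h1, h2, h3]
  simp only [hu.sum_ginv_nabla3_weylVec hn hG hdiv hy]
  have h4 := hG.sum_mul_electric (u := u) hy k
  have : ∀ m, u y m * -(φ y * electric G u y k m) = -φ y * (u y m * electric G u y k m) :=
    fun m => by ring
  simp only [this, ← Finset.mul_sum, h4]
  ring

theorem divElectric_eq_zero (hn : 3 < n) (hu : IsTorseFormingOn G S u φ)
    (hG : IsMetricOn G S) (hdiv : ∀ y ∈ S, ∀ j k l, divWeyl G y j k l = 0) (hy : y ∈ S)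
    (k : Fin n) : divElectric G u y k = 0 := by
  have : divElectric G u y k
      = ∑ b, ginv G y k b * ∑ p, ∑ a, ginv G y p a * nabla2 G (electric G u) y p b a := by
    simp only [divElectric, Finset.mul_sum]
    conv_rhs => rw [Finset.sum_comm]
    refine Finset.sum_congr rfl fun p _ => ?_
    conv_rhs => rw [Finset.sum_comm]
    refine Finset.sum_congr rfl fun a _ => Finset.sum_congr rfl fun b _ => ?_
    rw [hG.nabla2_electric_symm hy p a b]
    ring
  rw [this]
  simp [hu.sum_ginv_nabla2_electric hn hG hdiv hy]

theorem weylVec_eq (hn : 3 < n) (hu : IsTorseFormingOn G S u φ) (hG : IsMetricOn G S)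
    (hy : y ∈ S) (k l m : Fin n) :
    weylVec G u y k l m
      = lower G u y l * electric G u y m k - lower G u y m * electric G u y l k := by
  have h := hu.sum_mul_weyl hn hG hy l m k
  have : weylVec G u y k l m = -∑ j, u y j * weyl G y l m k j := by
    simp only [weylVec, ← Finset.sum_neg_distrib]
    refine Finset.sum_congr rfl fun j _ => ?_
    rw [hG.weyl_antisymm_right hy l m j k, hG.weyl_pair_symm hy j k l m]
    ring
  rw [this, h]
  ring

/-- The second evaluation of ∇W, now from the structure formula; here derivatives of E appear. -/
theorem nabla3_weylVec_eq (hn : 3 < n) (hu : IsTorseFormingOn G S u φ) (hG : IsMetricOn G S)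
    (hy : y ∈ S) (p k l m : Fin n) :
    nabla3 G (weylVec G u) y p k l m
      = nabla1 G (lower G u) y p l * electric G u y m k
        + lower G u y l * nabla2 G (electric G u) y p m k
        - nabla1 G (lower G u) y p m * electric G u y l k
        - lower G u y m * nabla2 G (electric G u) y p l k := by
  have d : ∀ {F : EuclideanSpace ℝ (Fin n) → ℝ}, ContDiffOn ℝ ∞ F S → DifferentiableAt ℝ F y :=
    fun hF => differentiableAt_of_smooth hG.isOpen hy hF
  have hw := fun a => d (hu.contDiffOn_lower hG a)
  have hE := fun a b => d (hu.contDiffOn_electric hG a b)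
  simp only [nabla3]
  rw [pd_congr hG.isOpen hy (fun z hz => hu.weylVec_eq hn hG hz k l m),
    pd_sub ((hw l).fun_mul (hE m k)) ((hw m).fun_mul (hE l k)),
    pd_mul (hw l) (hE m k), pd_mul (hw m) (hE l k)]
  simp only [hu.weylVec_eq hn hG hy, nabla1, nabla2, mul_sub, sub_mul, Finset.sum_sub_distrib,
    Finset.mul_sum, Finset.sum_mul]
  simp only [mul_left_comm (lower G u y _) (christoffel G y _ _ _) _, mul_assoc]
  ring

/-- Two values of the same divergence of W are compared. The factor n-1 is the trace of h in (∇^m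
u_m) E_{kl}, and u^p∇_pE_{kl} comes from differentiating E in u_m E_{kl}. -/
theorem alongElectric_eq (hn : 3 < n) (hu : IsTorseFormingOn G S u φ)
    (hG : IsMetricOn G S) (hdiv : ∀ y ∈ S, ∀ j k l, divWeyl G y j k l = 0) (hy : y ∈ S)
    (k l : Fin n) :
    alongElectric G u y k l = -φ y * ((n : ℝ) - 1) * electric G u y k l := by
  have h := hu.sum_ginv_nabla3_weylVec hn hG hdiv hy k l
  have e : ∀ p m, ginv G y p m * nabla3 G (weylVec G u) y p k l m
      = φ y * (ginv G y p m * (G y l p * electric G u y k m))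
        + φ y * lower G u y l * (ginv G y p m * (lower G u y p * electric G u y k m))
        + lower G u y l * (ginv G y p m * nabla2 G (electric G u) y p k m)
        - φ y * electric G u y k l
          * (ginv G y p m * (G y p m + lower G u y p * lower G u y m))
        - ginv G y p m * (nabla2 G (electric G u) y p k l * lower G u y m) := fun p m => by
    rw [hu.nabla3_weylVec_eq hn hG hy, hu.nabla y hy, hu.nabla y hy,
      hG.nabla2_electric_symm hy p m k, hG.nabla2_electric_symm hy p l k,
      hG.electric_symm hy m k, hG.electric_symm hy l k, hG.symm y hy p l]
    ring
  simp only [e, Finset.sum_sub_distrib, Finset.sum_add_distrib, ← Finset.mul_sum] at h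
  have h1 : ∑ p, ∑ m, ginv G y p m * (G y l p * electric G u y k m) = electric G u y k l := by
    rw [← hG.sum_ginv_mul_metric_mul hy (fun j => electric G u y k j) l,
      hG.sum_ginv_swap hy]
  have h2 : ∑ p, ∑ m, ginv G y p m * (lower G u y p * electric G u y k m) = 0 := by
    rw [← hG.sum_mul_electric (u := u) hy k, ← hG.sum_sum_ginv_mul_lower (u := u) hy,
      hG.sum_ginv_swap hy (fun p q => electric G u y k p * lower G u y q)]
    exact Finset.sum_congr rfl fun p _ => Finset.sum_congr rfl fun m _ => by ring
  rw [h1, h2, hu.sum_ginv_nabla2_electric hn hG hdiv hy, hu.sum_ginv_mul_projection hG hy,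
    hG.sum_sum_ginv_mul_lower hy] at h
  simp only [alongElectric]
  linarith

end IsTorseFormingOn

end

section

/-! ### The twisted coordinate form is torse-forming. -/

section Twisted

variable {n : ℕ} {G : EuclideanSpace ℝ (Fin n) → Matrix (Fin n) (Fin n) ℝ}
  {S : Set (EuclideanSpace ℝ (Fin n))} {y : EuclideanSpace ℝ (Fin n)} {t : Fin n}
  {f : EuclideanSpace ℝ (Fin n) → ℝ}
  {gstar : ({i : Fin n // i ≠ t} → ℝ) → Matrix {i : Fin n // i ≠ t} {i : Fin n // i ≠ t} ℝ}

theorem lower_single (j : Fin n) : lower G (fun _ => Pi.single t 1) y j = G y j t := by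
  simp [lower, Pi.single_apply]

/-- A differentiable function of the space coordinates has no time derivative. -/
theorem pd_eq_zero_of_space {ρ : ({i : Fin n // i ≠ t} → ℝ) → ℝ}
    (h : DifferentiableAt ℝ (fun z : EuclideanSpace ℝ (Fin n) => ρ fun μ => z μ.1) y) :
    pd t (fun z : EuclideanSpace ℝ (Fin n) => ρ fun μ => z μ.1) y = 0 := by
  rw [pd, ← h.lineDeriv_eq_fderiv, lineDeriv]
  have : (fun s : ℝ => ρ fun μ : {i : Fin n // i ≠ t} =>
      (y + s • EuclideanSpace.single t (1 : ℝ)) μ.1) = fun _ => ρ fun μ => y μ.1 := by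
    funext s
    congr 1
    funext μ
    simp [μ.2]
  rw [this, deriv_const]

namespace IsTwistedForm

theorem metric_time (h : IsTwistedForm G S t f gstar) (hy : y ∈ S) (j : Fin n) :
    G y j t = if j = t then -1 else 0 := by
  split_ifs with hj
  · rw [hj, h.time_time y hy]
  · exact (h.time_space y hy ⟨j, hj⟩).2

theorem pd_time_metric (h : IsTwistedForm G S t f gstar) (hG : IsMetricOn G S) (hy : y ∈ S)
    (μ ν : {i : Fin n // i ≠ t}) :
    pd t (fun z => G z μ.1 ν.1) y = 2 * (pd t f y / f y) * G y μ.1 ν.1 := by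
  have hf := differentiableAt_of_smooth hG.isOpen hy h.scale_smooth
  have hf0 : f y ≠ 0 := (h.scale_pos y hy).ne'
  -- Read off from g* = g/f² on the chart domain, which avoids discussing the projection of that
  -- domain to the space coordinates.
  have hstar : DifferentiableAt ℝ
      (fun z : EuclideanSpace ℝ (Fin n) => gstar (fun ρ => z ρ.1) μ ν) y := by
    refine ((differentiableAt_of_smooth hG.isOpen hy (hG.smooth μ.1 ν.1)).fun_mul
      ((hf.fun_mul hf).fun_inv (mul_self_ne_zero.2 hf0))).congr_of_eventuallyEq
      (Filter.eventuallyEq_of_mem (hG.isOpen.mem_nhds hy) fun z hz => ?_)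
    have : f z ≠ 0 := (h.scale_pos z hz).ne'
    simp only [h.space_space z hz]
    field_simp
  have hs := pd_eq_zero_of_space (ρ := fun x => gstar x μ ν) hstar
  have he : ∀ z ∈ S, G z μ.1 ν.1 = f z * f z * gstar (fun ρ => z ρ.1) μ ν := fun z hz => by
    rw [h.space_space z hz]; ring
  rw [pd_congr hG.isOpen hy he, pd_mul (hf.fun_mul hf) hstar, pd_mul hf hf, hs, he y hy]
  field_simp
  ring

/-- The components u_j = g_{jt} are constant, so ∇_i u_j = -Γ^q_{ij} g_{qt} = ½ ∂_t g_{ij}. On the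
space block this is φ g_{ij}; if i or j is t, both sides vanish. -/
theorem isTorseFormingOn (h : IsTwistedForm G S t f gstar) (hG : IsMetricOn G S) :
    IsTorseFormingOn G S (fun _ => Pi.single t 1) (fun y => pd t f y / f y) where
  smooth _ := contDiffOn_const
  unit y hy := by
    simp [lower_single, Pi.single_apply, h.time_time y hy]
  nabla y hy i j := by
    have hz : ∀ a b, pd a (fun z => G z b t) y = 0 := fun a b => by
      rw [pd_congr hG.isOpen hy (fun z hz => h.metric_time hz b), pd_const]
    have hz' : ∀ a b, pd a (fun z => G z t b) y = 0 := fun a b => by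
      rw [pd_congr hG.isOpen hy (fun z hz => hG.symm z hz t b), hz]
    simp only [nabla1, lower_single]
    rw [hG.sum_christoffel_mul_metric hy, hz, hz, h.metric_time hy i, h.metric_time hy j]
    by_cases hi : i = t
    · subst hi
      rw [hz', hG.symm y hy i j, h.metric_time hy j]
      by_cases hj : j = i <;> simp [hj]
    by_cases hj : j = t
    · subst hj
      rw [hz, h.metric_time hy i]
      simp [hi]
    rw [h.pd_time_metric hG hy ⟨i, hi⟩ ⟨j, hj⟩]
    simp only [hi, hj, if_false]
    ring

end IsTwistedForm

end Twisted

/-! ### From fields on the manifold to components in a chart. -/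

section Charts

variable {n : ℕ} {M : Type*} [TopologicalSpace M] [ChartedSpace (EuclideanSpace ℝ (Fin n)) M]
  {g : ∀ x : M, LinearMap.BilinForm ℝ (TangentSpace (𝓡 n) x)}
  {e : OpenPartialHomeomorph M (EuclideanSpace ℝ (Fin n))} {y : EuclideanSpace ℝ (Fin n)}

theorem mfderiv_chart_comp_symm (he : e ∈ IsManifold.maximalAtlas (𝓡 n) ∞ M)
    (hy : y ∈ e.target) (v : EuclideanSpace ℝ (Fin n)) :
    mfderiv (𝓡 n) (𝓡 n) e (e.symm y) (mfderiv (𝓡 n) (𝓡 n) e.symm y v) = v := by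
  have hd : e.MDifferentiable (𝓡 n) (𝓡 n) :=
    ⟨(contMDiffOn_of_mem_maximalAtlas he).mdifferentiableOn (by simp),
      (contMDiffOn_symm_of_mem_maximalAtlas he).mdifferentiableOn (by simp)⟩
  exact DFunLike.congr_fun (hd.comp_symm_deriv hy) v

/-- Both differentials are endomorphisms of the same finite-dimensional space, so a one-sided
inverse is two-sided. -/
theorem mfderiv_symm_comp_chart (he : e ∈ IsManifold.maximalAtlas (𝓡 n) ∞ M)
    (hy : y ∈ e.target) (v : TangentSpace (𝓡 n) (e.symm y)) :
    mfderiv (𝓡 n) (𝓡 n) e.symm y (mfderiv (𝓡 n) (𝓡 n) e (e.symm y) v) = v := by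
  let D : EuclideanSpace ℝ (Fin n) →L[ℝ] EuclideanSpace ℝ (Fin n) :=
    mfderiv (𝓡 n) (𝓡 n) e.symm y
  let D' : EuclideanSpace ℝ (Fin n) →L[ℝ] EuclideanSpace ℝ (Fin n) :=
    mfderiv (𝓡 n) (𝓡 n) e (e.symm y)
  have h : D'.toLinearMap * D.toLinearMap = 1 :=
    LinearMap.ext fun w => mfderiv_chart_comp_symm he hy w
  exact DFunLike.congr_fun (mul_eq_one_comm.1 h) v

theorem metric_mfderiv_symm (v w : EuclideanSpace ℝ (Fin n)) :
    g (e.symm y) (mfderiv (𝓡 n) (𝓡 n) e.symm y v) (mfderiv (𝓡 n) (𝓡 n) e.symm y w)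
      = ∑ i, v i * ∑ j, metricComp g e y i j * w j := by
  have hx : ∀ x : EuclideanSpace ℝ (Fin n),
      mfderiv (𝓡 n) (𝓡 n) e.symm y x = ∑ i, x i • coordVec e y i := by
    intro x
    have : x = ∑ i, x i • (EuclideanSpace.single i (1 : ℝ) : EuclideanSpace ℝ (Fin n)) := by
      ext j
      simp [Pi.single_apply]
    conv_lhs => rw [this]
    exact (map_sum _ _ _).trans (Finset.sum_congr rfl fun i _ => map_smul _ _ _)
  rw [hx v, hx w]
  simp only [map_sum, map_smul, LinearMap.sum_apply, LinearMap.smul_apply, smul_eq_mul,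
    metricComp, Matrix.of_apply, Finset.mul_sum]
  rw [Finset.sum_comm]
  exact Finset.sum_congr rfl fun i _ => Finset.sum_congr rfl fun j _ => by ring

variable [IsManifold (𝓡 n) ∞ M]

theorem IsLorentzian.eq_zero (hg : IsLorentzian g) (x : M) (v : TangentSpace (𝓡 n) x)
    (h : ∀ w, g x w v = 0) : v = 0 := by
  obtain ⟨b, hb⟩ := hg.signature x
  refine b.ext_elem fun i => ?_
  have hi := h (b i)
  rw [← b.sum_repr v] at hi
  simp only [map_sum, map_smul, hb, smul_eq_mul] at hi
  simp only [mul_ite, mul_zero, Finset.sum_ite_eq, Finset.mem_univ, if_true] at hi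
  rw [map_zero, Finsupp.zero_apply]
  split_ifs at hi <;> linarith

/-- For the determinant: a kernel vector of the component matrix would be the coordinates of a
tangent vector orthogonal to every vector, which the orthonormal basis excludes. -/
theorem IsLorentzian.isMetricOn (hg : IsLorentzian g)
    (he : e ∈ IsManifold.maximalAtlas (𝓡 n) ∞ M) : IsMetricOn (metricComp g e) e.target where
  isOpen := e.open_target
  symm _ _ _ _ := hg.symm _ _ _
  smooth := hg.smooth e he
  det_ne_zero y hy hdet := by
    obtain ⟨v, hv, h⟩ := Matrix.exists_mulVec_eq_zero_iff.2 hdet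
    have h0 : mfderiv (𝓡 n) (𝓡 n) e.symm y (WithLp.toLp 2 v) = 0 := by
      refine hg.eq_zero (e.symm y) _ fun w => ?_
      rw [← mfderiv_symm_comp_chart he hy w]
      refine (metric_mfderiv_symm _ _).trans (Finset.sum_eq_zero fun i _ => ?_)
      have hi : ∑ j, metricComp g e y i j * v j = 0 := congrFun h i
      exact mul_eq_zero_of_right _ hi
    refine hv (funext fun i => ?_)
    have h1 := mfderiv_chart_comp_symm he hy (WithLp.toLp 2 v)
    rw [h0] at h1
    exact (congrArg (fun z : EuclideanSpace ℝ (Fin n) => z i) (h1.symm.trans (map_zero _)))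

theorem IsTorseForming.isTorseFormingOn {u : ∀ x : M, TangentSpace (𝓡 n) x} {φ : M → ℝ}
    (h : IsTorseForming g u φ) (hu : IsSmoothField u) (hunit : ∀ x, g x (u x) (u x) = -1)
    (he : e ∈ IsManifold.maximalAtlas (𝓡 n) ∞ M) :
    IsTorseFormingOn (metricComp g e) e.target (vecComp u e) (fun y => φ (e.symm y)) where
  smooth := hu e he
  unit y hy := by
    have h1 := hunit (e.symm y)
    rw [← mfderiv_symm_comp_chart he hy (u (e.symm y))] at h1
    exact (metric_mfderiv_symm _ _).symm.trans h1
  nabla := h e he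

end Charts

end

end Spacetime

end

theorem mainTheorem4 {n : ℕ} (hn : 3 < n) {M : Type*} [TopologicalSpace M]
    [ChartedSpace (EuclideanSpace ℝ (Fin n)) M] [IsManifold (𝓡 n) ∞ M]
    (g : ∀ x : M, LinearMap.BilinForm ℝ (TangentSpace (𝓡 n) x))
    (hg : Spacetime.IsLorentzian g) (hdiv : Spacetime.IsWeylDivFree g) :
    -- twisted space-times in covariant form: a time-like unit torse-forming vector field
    (∀ (u : ∀ x : M, TangentSpace (𝓡 n) x) (φ : M → ℝ),
      Spacetime.IsSmoothField u → (∀ x, g x (u x) (u x) = -1) →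
      Spacetime.IsTorseForming g u φ →
      ∀ e ∈ IsManifold.maximalAtlas (𝓡 n) ∞ M, ∀ y ∈ e.target,
        (∀ k, Spacetime.divElectric (Spacetime.metricComp g e) (Spacetime.vecComp u e) y k = 0) ∧
        ∀ k m, Spacetime.alongElectric (Spacetime.metricComp g e) (Spacetime.vecComp u e) y k m
          = -φ (e.symm y) * ((n : ℝ) - 1)
            * Spacetime.electric (Spacetime.metricComp g e) (Spacetime.vecComp u e) y k m) ∧
    -- twisted space-times in coordinates: `-dt² + f² g*`, with `u = ∂_t` and `φ = ∂_t f / f`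
    (∀ e ∈ IsManifold.maximalAtlas (𝓡 n) ∞ M, ∀ (t : Fin n) (f : EuclideanSpace ℝ (Fin n) → ℝ)
      (gstar : ({i : Fin n // i ≠ t} → ℝ) → Matrix {i : Fin n // i ≠ t} {i : Fin n // i ≠ t} ℝ),
      Spacetime.IsTwistedForm (Spacetime.metricComp g e) e.target t f gstar →
      ∀ y ∈ e.target,
        (∀ k, Spacetime.divElectric (Spacetime.metricComp g e) (fun _ => Pi.single t 1) y k = 0) ∧
        ∀ k m, Spacetime.alongElectric (Spacetime.metricComp g e) (fun _ => Pi.single t 1) y k m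
          = -(Spacetime.pd t f y / f y) * ((n : ℝ) - 1)
            * Spacetime.electric (Spacetime.metricComp g e) (fun _ => Pi.single t 1) y k m) := by
  exact ⟨fun u φ hu hunit htorse e he y hy =>
      have h := htorse.isTorseFormingOn hu hunit he
      ⟨h.divElectric_eq_zero hn (hg.isMetricOn he) (hdiv e he) hy,
        h.alongElectric_eq hn (hg.isMetricOn he) (hdiv e he) hy⟩,
    fun e he t f gstar htw y hy =>
      have h := htw.isTorseFormingOn (hg.isMetricOn he)
      ⟨h.divElectric_eq_zero hn (hg.isMetricOn he) (hdiv e he) hy,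
        h.alongElectric_eq hn (hg.isMetricOn he) (hdiv e he) hy⟩⟩
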